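/- **Definitions.** Let $\Gamma=\mathrm{SL}_2(\mathbf Z)$ act on the upper half-plane $\mathcal H$, let $q=e^{2\pi i\tau}$, and for $\gamma=\begin{pmatrix}a&b\\c&d\end{pmatrix}\in\Gamma$ let $j(\gamma,\tau)=c\tau+d$ and $X(\gamma,\tau)=\frac{c}{c\tau+d}$. A quasi-vertex operator algebra (QVOA) over $\mathbf C$ is a vertex algebra $(V,Y,\mathbf 1)$ with $\mathbf 1\neq0$ and $Y(a,z)=\sum_n a(n)z^{-n-1}$, with a grading $V=\bigoplus_{n\in\mathbf Z}V_n$ such that $a(n)b\in V_{k+\ell-n-1}$ for $a\in V_k$, $b\in V_\ell$, each $V_n$ is finite-dimensional and $V_n=0$ for $n\ll0$, together with a representation $\rho$ of $\mathfrak{sl}_2$ on $V$ under which $\begin{pmatrix}1/2&0\\0&-1/2\end{pmatrix}$ acts as the operator $L(0)$ with $L(0)a=ka$ for $a\in V_k$, $\begin{pmatrix}0&1\\0&0\end{pmatrix}$ acts as $L(-1)\colon a\mapsto a(-2)\mathbf 1$, and $\begin{pmatrix}0&0\\-1&0\end{pmatrix}$ acts as an operator $L(1)$, such that $(L(-1)a)(n)=-n\,a(n-1)=[L(-1),a(n)]$,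 and $[L(1),a(n)]=(L(1)a)(n)+(2k-n-2)a(n+1)$ for $a\in V_k$. It is of CFT type if $V_0=\mathbf C\mathbf 1$. Let $V^{(2)}$ be $V$ with the doubled grading $V^{(2)}_{2n}=V_n$, and let $F_NV=\bigoplus_{n\le N}V_n$. A function from $\mathcal H$ to a finite-dimensional complex vector space $U$ is called *regular* if it is holomorphic on $\mathcal H$ and has an expansion $\sum_{n\ge0}a_nq^n$ with $a_n\in U$. Let $M=\bigoplus_kM_k$ be the graded algebra of holomorphic modular forms on $\Gamma$. Let $Q=\bigoplus_kQ_k$ be the graded algebra of holomorphic quasi-modular forms on $\Gamma$: $Q_k$ is the space of regular $f\colon\mathcal H\to\mathbf C$ for which there are $s\ge 0$ and regular functions $Q_0,\dots,Q_s$ with $j(\gamma,\tau)^{-k}f(\gamma\tau)=\sum_{n=0}^sX(\gamma,\tau)^nQ_n(\tau)$ for all $\gamma\in\Gamma$ and $\tau\in\mathcal H$. In particular $E_2=1-24\sum_{n\ge1}\sigma_1(n)q^n\in Q_2$. For $f\colon\mathcal H\to V$ put $(f\|_k\gamma)(\tau)=j(\gamma,\tau)^{-k}K(\gamma,\tau)^{-1}f(\gamma\tau)$,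 where $K(\gamma,\tau)=\exp(-c\,j(\gamma,\tau)L(1))\,j(\gamma,\tau)^{-2L(0)}$. Let $M_k(V)$ be the space of functions $f$ that are regular as maps to $F_NV$ for some $N$ and satisfy $f\|_k\gamma=f$ for all $\gamma\in\Gamma$. Let $Q_k(V)$ be the space of functions $f$ that are regular as maps to some $F_NV$ and for which $(f\|_k\gamma)(\tau)=\sum_{n=0}^sX(\gamma,\tau)^nQ_n(\tau)$ for all $\gamma\in\Gamma$ and $\tau\in\mathcal H$, with some $s\ge0$ and some regular $Q_n\colon\mathcal H\to F_NV$. Let $M(V)=\sum_{k\in\mathbf Z}M_k(V)$ and $Q(V)=\sum_{k\in\mathbf Z}Q_k(V)$, as spaces of functions on $\mathcal H$; these are modules over $M$ and $Q$ respectively, under pointwise multiplication. **Theorem.** Let $V$ be a QVOA of CFT type. The sums $M(V)=\bigoplus_kM_k(V)$ and $Q(V)=\bigoplus_kQ_k(V)$ are direct, and $\iota(f\otimes v)(\tau)=f(\tau)v$ defines a $Q$-linear isomorphism $\iota\colon Q\otimes_{\mathbf C}V^{(2)}\to Q(V)$ of graded spaces. The operator $$P=\exp\Bigl(-\frac{2\pi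 i}{12}E_2\otimes L(1)\Bigr),\qquad P(f\otimes v)=\sum_{n\ge0}\frac1{n!}\Bigl(-\frac{2\pi i}{12}E_2\Bigr)^nf\otimes L(1)^nv,$$ is a grading-preserving $Q$-linear automorphism of $Q\otimes_{\mathbf C}V^{(2)}$, and $\iota\circ P$ restricts to an $M$-linear isomorphism of graded spaces $$M\otimes_{\mathbf C}V^{(2)}\cong M(V).$$ Consequently every $M_k(V)$ is finite-dimensional, $M_k(V)=0$ if $k$ is odd or negative, and for every even $k\ge0$ $$\dim M_k(V)=\sum_{i=0}^{k/2}\dim M_{2i}\cdot\dim V_{\frac k2-i}.$$ -/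

import Mathlib

open UpperHalfPlane MatrixGroups TensorProduct
open scoped Manifold ModularForm

noncomputable section

/-! ## Exponentials of locally nilpotent operators -/

section Exponential

set_option linter.unusedSectionVars false

variable {R : Type*} [CommRing R] [Algebra ℚ R] {W : Type*} [AddCommGroup W] [Module R W]

/-- `T` is locally nilpotent: every vector is killed by some power of `T`. -/
def IsLocNilpotent (T : Module.End R W) : Prop :=
  ∀ w, ∃ n, (T ^ n) w = 0

lemma pow_apply_eq_zero_of_le {T : Module.End R W} {w : W} {n m : ℕ} (h : n ≤ m)
    (hn : (T ^ n) w = 0) : (T ^ m) w = 0 := by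
  obtain ⟨k, rfl⟩ := Nat.exists_eq_add_of_le h
  rw [add_comm, pow_add, Module.End.mul_apply, hn, map_zero]

lemma exp_support_subset {T : Module.End R W} {w : W} {n : ℕ} (hn : (T ^ n) w = 0) :
    (Function.support fun i : ℕ => algebraMap ℚ R ((i.factorial : ℚ)⁻¹) • (T ^ i) w) ⊆
      ↑(Finset.range n) := by
  intro i hi
  by_contra hni
  simp only [Finset.coe_range, Set.mem_Iio, not_lt] at hni
  exact hi (by simp [pow_apply_eq_zero_of_le hni hn])

lemma exp_finsum_eq {T : Module.End R W} {w : W} {n : ℕ} (hn : (T ^ n) w = 0) :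
    ∑ᶠ i : ℕ, algebraMap ℚ R ((i.factorial : ℚ)⁻¹) • (T ^ i) w =
      ∑ i ∈ Finset.range n, algebraMap ℚ R ((i.factorial : ℚ)⁻¹) • (T ^ i) w :=
  finsum_eq_sum_of_support_subset _ (exp_support_subset hn)

/-- The exponential `exp(T) w = ∑ i, (1 / i!) T ^ i w` of a locally nilpotent operator, as a linear
map. -/
def locExp (T : Module.End R W) (hT : IsLocNilpotent T) : Module.End R W where
  toFun w := ∑ᶠ i : ℕ, algebraMap ℚ R ((i.factorial : ℚ)⁻¹) • (T ^ i) w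
  map_add' v w := by
    obtain ⟨n, hn⟩ := hT v
    obtain ⟨m, hm⟩ := hT w
    rw [← finsum_add_distrib ((Finset.finite_toSet _).subset (exp_support_subset hn))
      ((Finset.finite_toSet _).subset (exp_support_subset hm))]
    simp
  map_smul' c w := by
    obtain ⟨n, hn⟩ := hT w
    have hn' : (T ^ n) (c • w) = 0 := by rw [map_smul, hn, smul_zero]
    rw [exp_finsum_eq hn, exp_finsum_eq hn', RingHom.id_apply, Finset.smul_sum]
    exact Finset.sum_congr rfl fun i _ => by rw [map_smul, smul_comm]

lemma locExp_apply_of_pow_eq_zero {T : Module.End R W} (hT : IsLocNilpotent T) {w : W} {n : ℕ}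
    (hn : (T ^ n) w = 0) :
    locExp T hT w = ∑ i ∈ Finset.range n, algebraMap ℚ R ((i.factorial : ℚ)⁻¹) • (T ^ i) w :=
  exp_finsum_eq hn

lemma neg_pow_apply {U : Type*} [AddCommGroup U] [Module R U] (T : Module.End R U) (i : ℕ) (x : U) :
    ((-T) ^ i) x = (-1 : R) ^ i • (T ^ i) x := by
  rw [show -T = (-1 : R) • T from LinearMap.ext fun _ => by simp, smul_pow, LinearMap.smul_apply]

lemma IsLocNilpotent.neg {T : Module.End R W} (hT : IsLocNilpotent T) : IsLocNilpotent (-T) := by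
  intro w
  obtain ⟨n, hn⟩ := hT w
  exact ⟨n, by rw [neg_pow_apply, hn, smul_zero]⟩

lemma IsLocNilpotent.smul {T : Module.End R W} (hT : IsLocNilpotent T) (c : R) :
    IsLocNilpotent (c • T) := by
  intro w
  obtain ⟨n, hn⟩ := hT w
  exact ⟨n, by rw [smul_pow, LinearMap.smul_apply, hn, smul_zero]⟩

lemma locExp_locExp_neg {T : Module.End R W} (hT : IsLocNilpotent T) (hT' : IsLocNilpotent (-T))
    (w : W) : locExp T hT (locExp (-T) hT' w) = w := by
  obtain ⟨n, hn⟩ := hT w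
  let K : Submodule R W := LinearMap.ker (T ^ n)
  have hK : ∀ x ∈ K, T x ∈ K := by
    intro x hx
    rw [LinearMap.mem_ker] at hx ⊢
    rw [← Module.End.mul_apply, ← pow_succ, pow_succ', Module.End.mul_apply, hx, map_zero]
  let S : Module.End R K := T.restrict hK
  let _ : Algebra ℚ (Module.End R K) := Algebra.compHom _ (algebraMap ℚ R)
  have hsm : ∀ (q : ℚ) (f : Module.End R K), q • f = algebraMap ℚ R q • f := fun q f => by
    rw [Algebra.smul_def, Algebra.smul_def]; rfl
  have hSpow : ∀ (i : ℕ) (x : K), ((S ^ i) x : W) = (T ^ i) x := by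
    intro i x
    induction i with
    | zero => simp
    | succ i ih => rw [pow_succ', pow_succ', Module.End.mul_apply, Module.End.mul_apply, ← ih]; rfl
  have hnegpow : ∀ (i : ℕ) (x : K), (((-S) ^ i) x : W) = ((-T) ^ i) x := by
    intro i x
    rw [neg_pow_apply, neg_pow_apply, Submodule.coe_smul, hSpow]
  have hS : S ^ n = 0 := by
    ext x
    rw [hSpow]
    exact x.2
  have hS' : (-S) ^ n = 0 := by
    ext x
    rw [neg_pow_apply, hS]
    simp
  have key1 : ∀ x : K, locExp T hT x = (IsNilpotent.exp S x : K) := by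
    intro x
    rw [locExp_apply_of_pow_eq_zero hT (w := (x : W)) (n := n) x.2, IsNilpotent.exp_eq_sum hS,
      LinearMap.sum_apply, AddSubmonoidClass.coe_finsetSum]
    exact Finset.sum_congr rfl fun i _ => by
      rw [hsm, LinearMap.smul_apply, Submodule.coe_smul, hSpow]
  have key2 : ∀ x : K, locExp (-T) hT' x = (IsNilpotent.exp (-S) x : K) := by
    intro x
    have hx : ((-T) ^ n) (x : W) = 0 := by rw [← hnegpow, hS']; rfl
    rw [locExp_apply_of_pow_eq_zero hT' hx, IsNilpotent.exp_eq_sum hS',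
      LinearMap.sum_apply, AddSubmonoidClass.coe_finsetSum]
    exact Finset.sum_congr rfl fun i _ => by
      rw [hsm, LinearMap.smul_apply, Submodule.coe_smul, hnegpow]
  have h1 := key2 ⟨w, hn⟩
  simp only at h1
  rw [h1, key1, ← Module.End.mul_apply, IsNilpotent.exp_mul_exp_neg_self ⟨n, hS⟩]
  rfl

/-- `exp(T)` as a linear automorphism, with inverse `exp(-T)`. -/
def locExpEquiv (T : Module.End R W) (hT : IsLocNilpotent T) : W ≃ₗ[R] W :=
  LinearEquiv.ofLinearMap (locExp T hT) (locExp (-T) hT.neg)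
    (LinearMap.ext fun w => locExp_locExp_neg hT hT.neg w)
    (LinearMap.ext fun w => by
      have h := locExp_locExp_neg hT.neg (by rw [neg_neg]; exact hT) w
      simp only [neg_neg] at h
      exact h)

end Exponential

/-! ## Quasi-vertex operator algebras -/

/-- A vertex algebra over `ℂ` with Fock space `V`. A field on `V` is a linear map from `V` to
Laurent series with coefficients in `V`, and `(Y a).ncoeff n` is the mode `a(n)`, the coefficient of
`z ^ (-n - 1)`. -/
structure VertexAlgebra (V : Type*) [AddCommGroup V] [Module ℂ V] where
  /-- the vacuum state -/
  vacuum : V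
  vacuum_ne_zero : vacuum ≠ 0
  /-- the state-field correspondence -/
  Y : V →ₗ[ℂ] VertexOperator ℂ V
  creative : ∀ (a : V) (n : ℤ), 0 ≤ n → (Y a).ncoeff n vacuum = 0
  creates : ∀ a : V, (Y a).ncoeff (-1) vacuum = a
  /-- the Jacobi identity; all sums have finite support because the `Y a` are fields -/
  jacobi : ∀ (a b c : V) (r s t : ℤ),
    ∑ᶠ i : ℕ, Ring.choose r i • (Y ((Y a).ncoeff (t + i) b)).ncoeff (r + s - i) c =
      ∑ᶠ i : ℕ, ((-1) ^ i * Ring.choose t i) •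
        ((Y a).ncoeff (r + t - i) ((Y b).ncoeff (s + i) c) -
          (Int.negOnePow t : ℤ) • (Y b).ncoeff (s + t - i) ((Y a).ncoeff (r + i) c))

/-- The mode `a(n)`. -/
def VertexAlgebra.mode {V : Type*} [AddCommGroup V] [Module ℂ V] (A : VertexAlgebra V) (a : V)
    (n : ℤ) : Module.End ℂ V :=
  (A.Y a).ncoeff n

/-- A `ℤ`-graded vertex algebra; elements of `gr k` are the states of conformal degree `k`. -/
structure GradedVertexAlgebra (V : Type*) [AddCommGroup V] [Module ℂ V] extends
    VertexAlgebra V where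
  /-- the homogeneous pieces `V_k` -/
  gr : ℤ → Submodule ℂ V
  isInternal : DirectSum.IsInternal gr
  mode_mem : ∀ (k l n : ℤ), ∀ a ∈ gr k, ∀ b ∈ gr l,
    toVertexAlgebra.mode a n b ∈ gr (k + l - n - 1)
  finiteDimensional : ∀ k, FiniteDimensional ℂ (gr k)
  bounded : ∃ N : ℤ, ∀ k < N, gr k = ⊥

/-- The element `diag(1/2, -1/2)` of `𝔰𝔩₂`. -/
def sl2H : LieAlgebra.SpecialLinear.sl (Fin 2) ℂ :=
  ⟨!![1 / 2, 0; 0, -1 / 2], by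
    change Matrix.trace !![(1 / 2 : ℂ), 0; 0, -1 / 2] = 0
    rw [Matrix.trace_fin_two_of]; norm_num⟩

/-- The element `(0 1; 0 0)` of `𝔰𝔩₂`. -/
def sl2E : LieAlgebra.SpecialLinear.sl (Fin 2) ℂ :=
  ⟨!![0, 1; 0, 0], by
    change Matrix.trace !![(0 : ℂ), 1; 0, 0] = 0
    rw [Matrix.trace_fin_two_of]; norm_num⟩

/-- The element `(0 0; -1 0)` of `𝔰𝔩₂`. -/
def sl2F : LieAlgebra.SpecialLinear.sl (Fin 2) ℂ :=
  ⟨!![0, 0; -1, 0], by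
    change Matrix.trace !![(0 : ℂ), 0; -1, 0] = 0
    rw [Matrix.trace_fin_two_of]; norm_num⟩

section QVOA

attribute [local instance] LieRing.ofAssociativeRing LieAlgebra.ofAssociativeAlgebra

/-- A quasi-vertex operator algebra: a `ℤ`-graded vertex algebra with a representation `ρ` of `𝔰𝔩₂`
for which `diag(1/2, -1/2)` acts as the Euler operator, `(0 1; 0 0)` as the canonical derivation
`a ↦ a(-2)𝟏`, and `(0 0; -1 0)` as an operator `δ = L(1)` satisfying `lowering`. -/
structure QVOA (V : Type*) [AddCommGroup V] [Module ℂ V] extends GradedVertexAlgebra V where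
  /-- the representation of `𝔰𝔩₂` on the Fock space -/
  ρ : LieAlgebra.SpecialLinear.sl (Fin 2) ℂ →ₗ⁅ℂ⁆ Module.End ℂ V
  euler : ∀ (k : ℤ), ∀ a ∈ gr k, ρ sl2H a = (k : ℂ) • a
  derivation : ∀ a, ρ sl2E a = toVertexAlgebra.mode a (-2) vacuum
  translation : ∀ (a : V) (n : ℤ),
    toVertexAlgebra.mode (ρ sl2E a) n = (-n : ℂ) • toVertexAlgebra.mode a (n - 1)
  translation_comm : ∀ (a : V) (n : ℤ),
    ρ sl2E * toVertexAlgebra.mode a n - toVertexAlgebra.mode a n * ρ sl2E =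
      (-n : ℂ) • toVertexAlgebra.mode a (n - 1)
  lowering : ∀ (k : ℤ), ∀ a ∈ gr k, ∀ n : ℤ,
    ρ sl2F * toVertexAlgebra.mode a n - toVertexAlgebra.mode a n * ρ sl2F =
      toVertexAlgebra.mode (ρ sl2F a) n +
        (2 * k - n - 2 : ℂ) • toVertexAlgebra.mode a (n + 1)

end QVOA

namespace QVOA

variable {V : Type*} [AddCommGroup V] [Module ℂ V] (A : QVOA V)

/-- CFT type: `V_0` is spanned by the vacuum. -/
def IsCFTType : Prop := A.gr 0 = Submodule.span ℂ {A.vacuum}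

/-- The Euler operator `L(0)`, which acts on `V_k` as `k`. -/
def L0 : Module.End ℂ V := A.ρ sl2H

/-- The lowering operator `L(1)`. -/
def L1 : Module.End ℂ V := A.ρ sl2F

/-- The truncation `F_N V`, the sum of the `V_n` with `n ≤ N`. -/
def trunc (N : ℤ) : Submodule ℂ V := ⨆ n ∈ Set.Iic N, A.gr n

section Bracket

attribute [local instance] LieRing.ofAssociativeRing LieAlgebra.ofAssociativeAlgebra

lemma L0_L1 (v : V) : A.L0 (A.L1 v) = A.L1 (A.L0 v) - A.L1 v := by
  have h : ⁅sl2H, sl2F⁆ = -sl2F := by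
    apply Subtype.ext
    rw [LieAlgebra.SpecialLinear.sl_bracket]
    ext i j
    fin_cases i <;> fin_cases j <;> (simp [sl2H, sl2F]; try norm_num)
  have h2 := congrArg (fun T : Module.End ℂ V => T v) (A.ρ.map_lie sl2H sl2F)
  simp only [h, map_neg] at h2
  have h3 : -(A.L1 v) = A.L0 (A.L1 v) - A.L1 (A.L0 v) := h2
  rw [sub_eq_add_neg, h3]
  abel

end Bracket

/-- The weight decomposition `⨁ n, V_n ≃ V`. -/
def decomp : (DirectSum ℤ fun n => A.gr n) ≃ₗ[ℂ] V :=
  LinearEquiv.ofBijective (DirectSum.coeLinearMap A.gr) A.isInternal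

lemma decomp_of (n : ℤ) (v : A.gr n) : A.decomp (DirectSum.of (fun n => A.gr n) n v) = v :=
  DirectSum.coeLinearMap_of A.gr n v

lemma L1_mem {k : ℤ} {v : V} (hv : v ∈ A.gr k) : A.L1 v ∈ A.gr (k - 1) := by
  have hL0 : ∀ x : DirectSum ℤ fun n => A.gr n, A.L0 (A.decomp x) =
      A.decomp (DirectSum.lmap (fun n : ℤ => (n : ℂ) • (LinearMap.id : A.gr n →ₗ[ℂ] A.gr n)) x) := by
    intro x
    induction x using DirectSum.induction_on with
    | zero => simp
    | of i x =>
      rw [← DirectSum.lof_eq_of ℂ, DirectSum.lmap_lof, DirectSum.lof_eq_of, DirectSum.lof_eq_of,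
        decomp_of, decomp_of]
      exact A.euler i x x.2
    | add x y hx hy => simp only [map_add, hx, hy]
  set x := A.decomp.symm (A.L1 v) with hx
  have hxv : A.decomp x = A.L1 v := by simp [hx]
  have h1 : A.L0 (A.L1 v) = ((k - 1 : ℤ) : ℂ) • A.L1 v := by
    have : A.L0 v = (k : ℂ) • v := A.euler k v hv
    rw [L0_L1, this, map_smul]
    push_cast
    rw [sub_smul, one_smul]
  rw [← hxv, hL0, ← map_smul] at h1
  have h2 := A.decomp.injective h1
  have h3 : ∀ n, n ≠ k - 1 → x n = 0 := by
    intro n hn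
    have := congrArg (fun y : DirectSum ℤ fun n => A.gr n => y n) h2
    simp only [DirectSum.lmap_apply, LinearMap.smul_apply, LinearMap.id_apply,
      DirectSum.smul_apply] at this
    rw [← sub_eq_zero, ← sub_smul, smul_eq_zero, ← Int.cast_sub, Int.cast_eq_zero,
      sub_eq_zero] at this
    exact this.resolve_left hn
  have h4 : x = DirectSum.of (fun n => A.gr n) (k - 1) (x (k - 1)) := by
    ext n : 1
    by_cases hn : n = k - 1
    · subst hn; simp
    · rw [h3 n hn, DirectSum.of_eq_of_ne _ _ _ hn]
  rw [← hxv, h4, decomp_of]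
  exact (x (k - 1)).2

lemma L1_pow_mem {k : ℤ} {v : V} (hv : v ∈ A.gr k) (n : ℕ) : (A.L1 ^ n) v ∈ A.gr (k - n) := by
  induction n with
  | zero => simpa using hv
  | succ n ih =>
    rw [pow_succ', Module.End.mul_apply]
    have := A.L1_mem ih
    rwa [show k - n - 1 = k - ((n + 1 : ℕ) : ℤ) by push_cast; ring] at this

lemma L1_locNilpotent : IsLocNilpotent A.L1 := by
  intro v
  have hv : v ∈ ⨆ n, A.gr n := by rw [A.isInternal.submodule_iSup_eq_top]; trivial
  induction hv using Submodule.iSup_induction' with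
  | mem k v hv =>
    obtain ⟨N, hN⟩ := A.bounded
    refine ⟨(k - N + 1).toNat, ?_⟩
    have := A.L1_pow_mem hv (k - N + 1).toNat
    rwa [hN _ (by have := Int.self_le_toNat (k - N + 1); omega), Submodule.mem_bot] at this
  | zero => exact ⟨0, by simp⟩
  | add v w _ _ hv hw =>
    obtain ⟨n, hn⟩ := hv
    obtain ⟨m, hm⟩ := hw
    exact ⟨n + m, by rw [map_add, pow_apply_eq_zero_of_le (Nat.le_add_right n m) hn,
      pow_apply_eq_zero_of_le (Nat.le_add_left m n) hm, add_zero]⟩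

/-- `x ^ L(0)` for `x ≠ 0`: multiplication by `x ^ n` on `V_n`. -/
def powL0 (x : ℂˣ) : V ≃ₗ[ℂ] V :=
  A.decomp.symm ≪≫ₗ
    (DFinsupp.mapRange.linearEquiv fun n : ℤ => LinearEquiv.smulOfUnit (x ^ n)) ≪≫ₗ A.decomp

lemma powL0_of_mem (x : ℂˣ) {n : ℤ} {v : V} (hv : v ∈ A.gr n) :
    A.powL0 x v = (x : ℂ) ^ n • v := by
  have h : A.decomp.symm v = DirectSum.of (fun n => A.gr n) n ⟨v, hv⟩ := by
    rw [LinearEquiv.symm_apply_eq, decomp_of]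
  have h2 : DFinsupp.mapRange.linearEquiv (fun n : ℤ => LinearEquiv.smulOfUnit (x ^ n))
      (DirectSum.of (fun n => A.gr n) n ⟨v, hv⟩) =
      DirectSum.of (fun n => A.gr n) n ((x ^ n : ℂˣ) • ⟨v, hv⟩) :=
    DFinsupp.mapRange_single (f := fun (i : ℤ) (y : A.gr i) => (x ^ i : ℂˣ) • y)
      (hf := fun _ => smul_zero _) (i := n) (b := ⟨v, hv⟩)
  simp only [powL0, LinearEquiv.trans_apply, h]
  rw [h2, decomp_of]
  simp [Units.smul_def]

end QVOA

/-! ## Scalar-valued modular and quasi-modular forms -/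

/-- The variable `q = exp(2πiτ)`. -/
def qVar (τ : ℍ) : ℂ := Complex.exp (2 * Real.pi * Complex.I * τ)

/-- The automorphy factor `j(γ, τ) = cτ + d`. -/
def autFactor (γ : SL(2, ℤ)) (τ : ℍ) : ℂˣ := Units.mk0 (denom γ τ) (denom_ne_zero γ τ)

/-- `X(γ, τ) = c / (cτ + d)`. -/
def cuspX (γ : SL(2, ℤ)) (τ : ℍ) : ℂ := (γ 1 0 : ℂ) / autFactor γ τ

section Forms

variable {U : Type*} [AddCommGroup U] [Module ℂ U]

/-- The functions from the upper half-plane to a (finite-dimensional) subspace `W` of `U` that are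
holomorphic, and holomorphic at the cusp: they have a `q`-expansion `f = ∑ n, a n q ^ n` with
`a n ∈ W` for `n ≥ 0`. Holomorphy and convergence are tested on linear functionals. -/
def holomorphicForms (W : Submodule ℂ U) : Submodule ℂ (ℍ → U) where
  carrier := {f | (∀ τ, f τ ∈ W) ∧
    (∀ φ : Module.Dual ℂ U, MDifferentiable 𝓘(ℂ) 𝓘(ℂ) fun τ => φ (f τ)) ∧
    ∃ a : ℕ → U, (∀ n, a n ∈ W) ∧
      ∀ (φ : Module.Dual ℂ U) (τ : ℍ), HasSum (fun n => φ (a n) * qVar τ ^ n) (φ (f τ))}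
  zero_mem' := ⟨fun _ => W.zero_mem, fun φ => by
    simpa using (mdifferentiable_const : MDifferentiable 𝓘(ℂ) 𝓘(ℂ) fun _ : ℍ => (0 : ℂ)),
    0, fun _ => W.zero_mem, fun φ τ => by simp⟩
  add_mem' := by
    rintro f g ⟨hf, hf', a, ha, ha'⟩ ⟨hg, hg', b, hb, hb'⟩
    refine ⟨fun τ => W.add_mem (hf τ) (hg τ), fun φ => ?_, a + b,
      fun n => W.add_mem (ha n) (hb n), fun φ τ => ?_⟩
    · simpa using! (hf' φ).add (hg' φ)
    · simpa [add_mul] using (ha' φ τ).add (hb' φ τ)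
  smul_mem' := by
    rintro c f ⟨hf, hf', a, ha, ha'⟩
    refine ⟨fun τ => W.smul_mem c (hf τ), fun φ => ?_, c • a, fun n => W.smul_mem c (ha n),
      fun φ τ => ?_⟩
    · simpa using! (hf' φ).const_smul c
    · simpa [mul_assoc] using (ha' φ τ).mul_left c

lemma holomorphicForms_mono {W W' : Submodule ℂ U} (h : W ≤ W') :
    holomorphicForms W ≤ holomorphicForms W' := by
  rintro f ⟨hf, hf', a, ha, ha'⟩
  exact ⟨fun τ => h (hf τ), hf', a, fun n => h (ha n), ha'⟩

lemma smul_mem_holomorphicForms {W : Submodule ℂ U} {f : ℍ → ℂ} {g : ℍ → U}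
    (hf : f ∈ holomorphicForms (⊤ : Submodule ℂ ℂ)) (hg : g ∈ holomorphicForms W) :
    f • g ∈ holomorphicForms W := by
  obtain ⟨-, hf', a, -, ha'⟩ := hf
  obtain ⟨hg, hg', b, hb, hb'⟩ := hg
  refine ⟨fun τ => W.smul_mem _ (hg τ), fun φ => ?_,
    fun n => ∑ p ∈ Finset.HasAntidiagonal.antidiagonal n, a p.1 • b p.2,
    fun n => W.sum_mem fun p _ => W.smul_mem _ (hb _), fun φ τ => ?_⟩
  · simpa using! (hf' LinearMap.id).mul (hg' φ)
  · have h1 := ha' LinearMap.id τ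
    have h2 := hb' φ τ
    simp only [LinearMap.id_apply] at h1
    have h3 := (summable_norm_sum_mul_antidiagonal_of_summable_norm h1.summable.norm
      h2.summable.norm).of_norm.hasSum
    rw [← tsum_mul_tsum_eq_tsum_sum_antidiagonal_of_summable_norm h1.summable.norm
      h2.summable.norm, h1.tsum_eq, h2.tsum_eq] at h3
    convert! h3 using 1
    · ext n
      rw [map_sum, Finset.sum_mul]
      refine Finset.sum_congr rfl fun p hp => ?_
      rw [map_smul, smul_eq_mul, ← Finset.HasAntidiagonal.mem_antidiagonal.mp hp, pow_add]
      ring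
    · simp

/-- `F γ τ` is a polynomial `∑ n ≤ s, X(γ, τ) ^ n Q_n(τ)` in `X(γ, τ)` whose coefficients `Q_n` lie
in the given space `B` of functions and do not depend on `γ`. -/
def HasQuasiExpansion (B : Submodule ℂ (ℍ → U)) (F : SL(2, ℤ) → ℍ → U) : Prop :=
  ∃ (s : ℕ) (Q : ℕ → ℍ → U), (∀ n, Q n ∈ B) ∧
    ∀ γ τ, F γ τ = ∑ n ∈ Finset.range (s + 1), cuspX γ τ ^ n • Q n τ

lemma HasQuasiExpansion.mono {B B' : Submodule ℂ (ℍ → U)} (h : B ≤ B')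
    {F : SL(2, ℤ) → ℍ → U} (hF : HasQuasiExpansion B F) : HasQuasiExpansion B' F := by
  obtain ⟨s, Q, hQ, hF⟩ := hF
  exact ⟨s, Q, fun n => h (hQ n), hF⟩

lemma HasQuasiExpansion.add {B : Submodule ℂ (ℍ → U)} {F G : SL(2, ℤ) → ℍ → U}
    (hF : HasQuasiExpansion B F) (hG : HasQuasiExpansion B G) : HasQuasiExpansion B (F + G) := by
  obtain ⟨s, P, hP, hF⟩ := hF
  obtain ⟨t, Q, hQ, hG⟩ := hG
  refine ⟨s + t, fun n => (if n ∈ Finset.range (s + 1) then P n else 0) +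
    (if n ∈ Finset.range (t + 1) then Q n else 0), fun n => ?_, fun γ τ => ?_⟩
  · refine B.add_mem ?_ ?_ <;> split_ifs
    exacts [hP n, B.zero_mem, hQ n, B.zero_mem]
  · have hs : Finset.range (s + 1) ⊆ Finset.range (s + t + 1) := by
      intro n; simp only [Finset.mem_range]; omega
    have ht : Finset.range (t + 1) ⊆ Finset.range (s + t + 1) := by
      intro n; simp only [Finset.mem_range]; omega
    simp only [Pi.add_apply, smul_add, Finset.sum_add_distrib]
    rw [hF, hG, ← Finset.sum_subset hs, ← Finset.sum_subset ht]
    · congr 1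
      · exact Finset.sum_congr rfl fun n hn => by rw [if_pos hn]
      · exact Finset.sum_congr rfl fun n hn => by rw [if_pos hn]
    · intro n _ hn; rw [if_neg hn]; simp
    · intro n _ hn; rw [if_neg hn]; simp

lemma HasQuasiExpansion.smul {B : Submodule ℂ (ℍ → U)} {F : SL(2, ℤ) → ℍ → U} (c : ℂ)
    (hF : HasQuasiExpansion B F) : HasQuasiExpansion B (c • F) := by
  obtain ⟨s, P, hP, hF⟩ := hF
  refine ⟨s, fun n => c • P n, fun n => B.smul_mem c (hP n), fun γ τ => ?_⟩
  simp only [Pi.smul_apply, hF, Finset.smul_sum]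
  exact Finset.sum_congr rfl fun n _ => smul_comm _ _ _

lemma HasQuasiExpansion.zero (B : Submodule ℂ (ℍ → U)) : HasQuasiExpansion B 0 :=
  ⟨0, 0, fun _ => B.zero_mem, fun γ τ => by simp⟩

lemma HasQuasiExpansion.mul {W : Submodule ℂ U} {F : SL(2, ℤ) → ℍ → ℂ} {G : SL(2, ℤ) → ℍ → U}
    (hF : HasQuasiExpansion (holomorphicForms (⊤ : Submodule ℂ ℂ)) F)
    (hG : HasQuasiExpansion (holomorphicForms W) G) :
    HasQuasiExpansion (holomorphicForms W) fun γ => F γ • G γ := by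
  obtain ⟨s, P, hP, hF⟩ := hF
  obtain ⟨t, Q, hQ, hG⟩ := hG
  refine ⟨s + t, fun n => ∑ p ∈ Finset.range (s + 1) ×ˢ Finset.range (t + 1) with p.1 + p.2 = n,
    P p.1 • Q p.2, fun n => Submodule.sum_mem _ fun p _ =>
      smul_mem_holomorphicForms (hP _) (hQ _), fun γ τ => ?_⟩
  have hmap : ∀ p ∈ Finset.range (s + 1) ×ˢ Finset.range (t + 1),
      p.1 + p.2 ∈ Finset.range (s + t + 1) := by
    intro p hp
    simp only [Finset.mem_product, Finset.mem_range] at hp ⊢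
    omega
  change F γ τ • G γ τ = _
  rw [hF, hG, Finset.sum_smul_sum, ← Finset.sum_product',
    ← Finset.sum_fiberwise_of_maps_to hmap]
  refine Finset.sum_congr rfl fun n _ => ?_
  dsimp only
  rw [Finset.sum_apply, Finset.smul_sum]
  refine Finset.sum_congr rfl fun p hp => ?_
  rw [← (Finset.mem_filter.mp hp).2, Pi.smul_apply', pow_add]
  simp only [smul_smul, smul_eq_mul]
  congr 1
  ring

end Forms

/-- The space `M_k` of holomorphic modular forms of weight `k` on `SL₂(ℤ)`, as functions. -/
def modularFormSpace (k : ℤ) : Submodule ℂ (ℍ → ℂ) where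
  carrier := {f | ∃ g : ModularForm 𝒮ℒ k, ⇑g = f}
  zero_mem' := ⟨0, rfl⟩
  add_mem' := by
    rintro _ _ ⟨f, rfl⟩ ⟨g, rfl⟩
    exact ⟨f + g, rfl⟩
  smul_mem' := by
    rintro c _ ⟨f, rfl⟩
    exact ⟨c • f, rfl⟩

/-- The space `Q_k` of holomorphic quasi-modular forms of weight `k` on `SL₂(ℤ)`: functions `f`,
holomorphic on the upper half-plane and at the cusp, such that `f ∣[k] γ = ∑ n ≤ s, X(γ, τ) ^ n Q_n`
for some functions `Q_n` that are holomorphic on the upper half-plane and at the cusp. -/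
def quasiModularFormSpace (k : ℤ) : Submodule ℂ (ℍ → ℂ) where
  carrier := {f | f ∈ holomorphicForms (⊤ : Submodule ℂ ℂ) ∧
    HasQuasiExpansion (holomorphicForms (⊤ : Submodule ℂ ℂ)) fun γ => f ∣[k] γ}
  zero_mem' := ⟨Submodule.zero_mem _, by
    simpa only [SlashAction.zero_slash] using! HasQuasiExpansion.zero _⟩
  add_mem' := by
    rintro f g ⟨hf, hf'⟩ ⟨hg, hg'⟩
    refine ⟨Submodule.add_mem _ hf hg, ?_⟩
    simpa only [SlashAction.add_slash] using! hf'.add hg'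
  smul_mem' := by
    rintro c f ⟨hf, hf'⟩
    refine ⟨Submodule.smul_mem _ c hf, ?_⟩
    simpa only [ModularForm.SL_smul_slash] using! hf'.smul c

lemma const_mem_holomorphicForms {U : Type*} [AddCommGroup U] [Module ℂ U] (W : Submodule ℂ U)
    {u : U} (hu : u ∈ W) : (fun _ => u) ∈ holomorphicForms W := by
  refine ⟨fun _ => hu, fun φ => mdifferentiable_const, fun n => if n = 0 then u else 0,
    fun n => by dsimp only; split_ifs; exacts [hu, W.zero_mem], fun φ τ => ?_⟩
  convert! hasSum_single (f := fun n => φ (if n = 0 then u else 0) * qVar τ ^ n) 0 ?_ using 1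
  · simp
  · intro n hn; simp [hn]

lemma slash_eq {k : ℤ} (f : ModularForm 𝒮ℒ k) (γ : SL(2, ℤ)) : (f : ℍ → ℂ) ∣[k] γ = f :=
  f.slash_action_eq' _ ⟨γ, rfl⟩

lemma dual_apply (φ : Module.Dual ℂ ℂ) (z : ℂ) : φ z = z * φ 1 := by
  rw [← smul_eq_mul, ← map_smul, smul_eq_mul, mul_one]

lemma modularFormSpace_le (k : ℤ) : modularFormSpace k ≤ quasiModularFormSpace k := by
  rintro _ ⟨f, rfl⟩
  have hf : (f : ℍ → ℂ) ∈ holomorphicForms (⊤ : Submodule ℂ ℂ) := by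
    refine ⟨fun _ => trivial, fun φ => ?_, fun n => (qExpansion 1 f).coeff n, fun _ => trivial,
      fun φ τ => ?_⟩
    · have h : MDifferentiable 𝓘(ℂ) 𝓘(ℂ) (f : ℍ → ℂ) := f.holo'
      have h2 : (fun τ => φ (f τ)) = φ 1 • (f : ℍ → ℂ) := by
        ext τ; rw [dual_apply, Pi.smul_apply, smul_eq_mul, mul_comm]
      rw [h2]
      exact h.const_smul (φ 1)
    · have h := (ModularForm.hasSum_qExpansion (f := f) one_pos (by simp) τ).mul_left (φ 1)
      rw [dual_apply φ (f τ)]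
      convert! h using 1
      · ext n
        rw [dual_apply φ]
        simp only [Function.Periodic.qParam, qVar, Complex.ofReal_one, div_one]
        ring
      · ring
  refine ⟨hf, 0, fun _ => f, fun _ => hf, fun γ τ => ?_⟩
  simp only [zero_add, Finset.range_one, Finset.sum_singleton, pow_zero, one_smul]
  exact congrFun (slash_eq f γ) τ

instance : SetLike.GradedMonoid modularFormSpace where
  one_mem := ⟨1, rfl⟩
  mul_mem := by
    rintro k l _ _ ⟨f, rfl⟩ ⟨g, rfl⟩
    exact ⟨f.mul g, rfl⟩

instance : SetLike.GradedMonoid quasiModularFormSpace where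
  one_mem := modularFormSpace_le 0 ⟨1, rfl⟩
  mul_mem := by
    rintro k l f g ⟨hf, hf'⟩ ⟨hg, hg'⟩
    refine ⟨smul_mem_holomorphicForms hf hg, ?_⟩
    simpa only [ModularForm.mul_slash_SL2] using! hf'.mul hg'

/-- The algebra `M = ⨁ k, M_k` of holomorphic modular forms on `SL₂(ℤ)`, as functions. -/
def modularAlgebra : Subalgebra ℂ (ℍ → ℂ) := (DirectSum.coeAlgHom modularFormSpace).range

/-- The algebra `Q = ⨁ k, Q_k` of holomorphic quasi-modular forms on `SL₂(ℤ)`, as functions. -/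
def quasiModularAlgebra : Subalgebra ℂ (ℍ → ℂ) := (DirectSum.coeAlgHom quasiModularFormSpace).range

lemma mem_modularAlgebra {f : ℍ → ℂ} : f ∈ modularAlgebra ↔ f ∈ ⨆ k, modularFormSpace k := by
  rw [Submodule.iSup_eq_toSubmodule_range]; rfl

lemma mem_quasiModularAlgebra {f : ℍ → ℂ} :
    f ∈ quasiModularAlgebra ↔ f ∈ ⨆ k, quasiModularFormSpace k := by
  rw [Submodule.iSup_eq_toSubmodule_range]; rfl

lemma modularAlgebra_le : modularAlgebra ≤ quasiModularAlgebra := fun f hf => by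
  rw [mem_modularAlgebra] at hf
  rw [mem_quasiModularAlgebra]
  exact iSup_mono modularFormSpace_le hf

lemma E2_mem : EisensteinSeries.E2 ∈ quasiModularFormSpace 2 := by
  have hE : EisensteinSeries.E2 ∈ holomorphicForms (⊤ : Submodule ℂ ℂ) := by
    refine ⟨fun _ => trivial, fun φ => ?_,
      fun m => if m = 0 then 1 else -24 * ArithmeticFunction.sigma 1 m, fun _ => trivial,
      fun φ τ => ?_⟩
    · have h : MDifferentiable 𝓘(ℂ) 𝓘(ℂ) EisensteinSeries.E2 :=
        E2_mdifferentiable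
      have h2 : (fun τ => φ (EisensteinSeries.E2 τ)) = φ 1 • EisensteinSeries.E2 := by
        ext τ; rw [dual_apply, Pi.smul_apply, smul_eq_mul, mul_comm]
      rw [h2]
      exact h.const_smul (φ 1)
    · have h := (EisensteinSeries.hasSum_qExpansion_E2 τ).mul_left (φ 1)
      rw [dual_apply φ (EisensteinSeries.E2 τ)]
      convert! h using 1
      · ext n
        rw [dual_apply φ, smul_eq_mul]
        simp only [qVar]
        ring
      · ring
  refine ⟨hE, 1, fun n => if n = 0 then EisensteinSeries.E2 else
    fun _ => 12 / (2 * Real.pi * Complex.I), fun n => ?_, fun γ τ => ?_⟩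
  · dsimp only
    split_ifs
    exacts [hE, const_mem_holomorphicForms _ trivial]
  · dsimp only
    rw [EisensteinSeries.E2_slash_action, Finset.sum_range_succ, Finset.sum_range_one]
    simp only [Pi.sub_apply, Pi.smul_apply, EisensteinSeries.D2, riemannZeta_two, cuspX, autFactor,
      Units.val_mk0, smul_eq_mul, if_true, if_neg one_ne_zero, pow_zero, pow_one, one_mul]
    have h1 := denom_ne_zero γ τ
    have h2 : (Real.pi : ℂ) ≠ 0 := by exact_mod_cast Real.pi_ne_zero
    have h3 := Complex.I_ne_zero
    have h4 := Complex.I_sq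
    field_simp
    linear_combination (-12 * ((γ 1 0 : ℤ) : ℂ)) * h4

/-- The Eisenstein series `E₂ = 1 - 24 ∑ n ≥ 1, σ₁(n) q ^ n` as an element of `Q`. -/
def E2 : quasiModularAlgebra :=
  ⟨EisensteinSeries.E2, mem_quasiModularAlgebra.mpr (Submodule.mem_iSup_of_mem 2 E2_mem)⟩

/-- The weight grading of `M`. -/
def modularGrading (k : ℤ) : Submodule ℂ modularAlgebra :=
  (modularFormSpace k).comap modularAlgebra.val.toLinearMap

/-- The weight grading of `Q`. -/
def quasiModularGrading (k : ℤ) : Submodule ℂ quasiModularAlgebra :=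
  (quasiModularFormSpace k).comap quasiModularAlgebra.val.toLinearMap

/-- The tensor product grading: the piece of degree `k` is `∑ i + j = k, 𝒜 i ⊗ ℬ j`. -/
def tensorGrading {X Y : Type*} [AddCommGroup X] [Module ℂ X] [AddCommGroup Y] [Module ℂ Y]
    (𝒜 : ℤ → Submodule ℂ X) (ℬ : ℤ → Submodule ℂ Y) (k : ℤ) : Submodule ℂ (X ⊗[ℂ] Y) :=
  ⨆ p ∈ {p : ℤ × ℤ | p.1 + p.2 = k}, Submodule.map₂ (TensorProduct.mk ℂ X Y) (𝒜 p.1) (ℬ p.2)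

/-! ## Modular and quasi-modular forms with values in a quasi-vertex operator algebra -/

namespace QVOA

variable {V : Type*} [AddCommGroup V] [Module ℂ V] (A : QVOA V)

/-- The grading of the doubled space `V^{(2)}`: `V^{(2)}_{2n} = V_n`. -/
def doubledGrading (k : ℤ) : Submodule ℂ V := if Even k then A.gr (k / 2) else ⊥

/-- The cocycle `K(γ, τ) = exp(-c j(γ, τ) L(1)) j(γ, τ) ^ (-2 L(0))` on `SL₂(ℤ)`. -/
def K (γ : SL(2, ℤ)) (τ : ℍ) : V ≃ₗ[ℂ] V :=
  A.powL0 (autFactor γ τ ^ (-2 : ℤ)) ≪≫ₗ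
    locExpEquiv ((-(γ 1 0 : ℂ) * autFactor γ τ) • A.L1) (A.L1_locNilpotent.smul _)

/-- The slash operator `f‖_k γ (τ) = j(γ, τ) ^ (-k) K(γ, τ)⁻¹ f(γτ)`. -/
def slash (k : ℤ) (γ : SL(2, ℤ)) (f : ℍ → V) (τ : ℍ) : V :=
  (autFactor γ τ : ℂ) ^ (-k) • (A.K γ τ).symm (f (γ • τ))

lemma slash_zero (k : ℤ) (γ : SL(2, ℤ)) : A.slash k γ 0 = 0 := by
  ext τ; simp [slash]

lemma slash_add (k : ℤ) (γ : SL(2, ℤ)) (f g : ℍ → V) :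
    A.slash k γ (f + g) = A.slash k γ f + A.slash k γ g := by
  ext τ; simp [slash]

lemma slash_smul (k : ℤ) (γ : SL(2, ℤ)) (c : ℂ) (f : ℍ → V) :
    A.slash k γ (c • f) = c • A.slash k γ f := by
  ext τ; simp only [slash, Pi.smul_apply, map_smul]; rw [smul_comm]

lemma slash_mul (k l : ℤ) (γ : SL(2, ℤ)) (f : ℍ → ℂ) (g : ℍ → V) :
    A.slash (k + l) γ (f • g) = (f ∣[k] γ) • A.slash l γ g := by
  ext τ
  simp only [slash, Pi.smul_apply', map_smul, ModularForm.SL_slash_apply, smul_smul]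
  congr 1
  rw [neg_add, zpow_add₀ (autFactor γ τ).ne_zero]
  simp only [autFactor, Units.val_mk0]
  ring

lemma trunc_mono {N N' : ℤ} (h : N ≤ N') : A.trunc N ≤ A.trunc N' :=
  biSup_mono fun _ hn => le_trans hn h

/-- The space `M_k(V)` of holomorphic `V`-valued modular forms of weight `k`: holomorphic functions
`f` from the upper half-plane to some `F_N V`, holomorphic at the cusp, with `f‖_k γ = f` for all
`γ` in `SL₂(ℤ)`. -/
def modularForms (k : ℤ) : Submodule ℂ (ℍ → V) where
  carrier := {f | (∃ N, f ∈ holomorphicForms (A.trunc N)) ∧ ∀ γ, A.slash k γ f = f}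
  zero_mem' := ⟨⟨0, Submodule.zero_mem _⟩, A.slash_zero k⟩
  add_mem' := by
    rintro f g ⟨⟨N, hf⟩, hf'⟩ ⟨⟨N', hg⟩, hg'⟩
    exact ⟨⟨max N N', Submodule.add_mem _
      (holomorphicForms_mono (A.trunc_mono (le_max_left _ _)) hf)
      (holomorphicForms_mono (A.trunc_mono (le_max_right _ _)) hg)⟩,
      fun γ => by rw [slash_add, hf', hg']⟩
  smul_mem' := by
    rintro c f ⟨⟨N, hf⟩, hf'⟩
    exact ⟨⟨N, Submodule.smul_mem _ c hf⟩, fun γ => by rw [slash_smul, hf']⟩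

/-- The space `Q_k(V)` of holomorphic `V`-valued quasi-modular forms of weight `k`: functions `f`
from the upper half-plane to some `F_N V`, holomorphic on the upper half-plane and at the cusp, such
that `f‖_k γ (τ) = ∑ n ≤ s, X(γ, τ) ^ n Q_n(τ)` for some functions `Q_n` of the same type. -/
def quasiModularForms (k : ℤ) : Submodule ℂ (ℍ → V) where
  carrier := {f | ∃ N, f ∈ holomorphicForms (A.trunc N) ∧
    HasQuasiExpansion (holomorphicForms (A.trunc N)) fun γ => A.slash k γ f}
  zero_mem' := ⟨0, Submodule.zero_mem _, by
    simpa only [slash_zero] using! HasQuasiExpansion.zero _⟩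
  add_mem' := by
    rintro f g ⟨N, hf, hf'⟩ ⟨N', hg, hg'⟩
    have h1 := holomorphicForms_mono (A.trunc_mono (le_max_left N N'))
    have h2 := holomorphicForms_mono (A.trunc_mono (le_max_right N N'))
    refine ⟨max N N', Submodule.add_mem _ (h1 hf) (h2 hg), ?_⟩
    simpa only [slash_add] using! (hf'.mono h1).add (hg'.mono h2)
  smul_mem' := by
    rintro c f ⟨N, hf, hf'⟩
    refine ⟨N, Submodule.smul_mem _ c hf, ?_⟩
    simpa only [slash_smul] using! hf'.smul c

lemma smul_mem_modularForms {k l : ℤ} {f : ℍ → ℂ} {g : ℍ → V} (hf : f ∈ modularFormSpace k)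
    (hg : g ∈ A.modularForms l) : f • g ∈ A.modularForms (k + l) := by
  obtain ⟨⟨N, hg⟩, hg'⟩ := hg
  refine ⟨⟨N, smul_mem_holomorphicForms (modularFormSpace_le k hf).1 hg⟩, fun γ => ?_⟩
  obtain ⟨f, rfl⟩ := hf
  rw [slash_mul, hg', slash_eq]

lemma smul_mem_quasiModularForms {k l : ℤ} {f : ℍ → ℂ} {g : ℍ → V}
    (hf : f ∈ quasiModularFormSpace k) (hg : g ∈ A.quasiModularForms l) :
    f • g ∈ A.quasiModularForms (k + l) := by
  obtain ⟨N, hg, hg'⟩ := hg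
  refine ⟨N, smul_mem_holomorphicForms hf.1 hg, ?_⟩
  simpa only [slash_mul] using! hf.2.mul hg'

/-- The `M`-module `M(V) = ⨁ k, M_k(V)` of `V`-valued modular forms. -/
def modularModule : Submodule modularAlgebra (ℍ → V) where
  carrier := {f | f ∈ ⨆ k, A.modularForms k}
  zero_mem' := Submodule.zero_mem (⨆ k, A.modularForms k)
  add_mem' hf hg := Submodule.add_mem (⨆ k, A.modularForms k) hf hg
  smul_mem' := by
    rintro ⟨f, hf'⟩ g hg
    have hf := mem_modularAlgebra.mp hf'
    change f • g ∈ ⨆ k, A.modularForms k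
    change g ∈ ⨆ k, A.modularForms k at hg
    clear hf'
    induction hf using Submodule.iSup_induction' with
    | zero => rw [zero_smul]; exact Submodule.zero_mem _
    | add a b _ _ ha hb => rw [add_smul]; exact Submodule.add_mem _ ha hb
    | mem k f hf =>
      induction hg using Submodule.iSup_induction' with
      | zero => rw [smul_zero]; exact Submodule.zero_mem _
      | add a b _ _ ha hb => rw [smul_add]; exact Submodule.add_mem _ ha hb
      | mem l g hg => exact Submodule.mem_iSup_of_mem (k + l) (A.smul_mem_modularForms hf hg)

/-- The `Q`-module `Q(V) = ⨁ k, Q_k(V)` of `V`-valued quasi-modular forms. -/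
def quasiModularModule : Submodule quasiModularAlgebra (ℍ → V) where
  carrier := {f | f ∈ ⨆ k, A.quasiModularForms k}
  zero_mem' := Submodule.zero_mem (⨆ k, A.quasiModularForms k)
  add_mem' hf hg := Submodule.add_mem (⨆ k, A.quasiModularForms k) hf hg
  smul_mem' := by
    rintro ⟨f, hf'⟩ g hg
    have hf := mem_quasiModularAlgebra.mp hf'
    change f • g ∈ ⨆ k, A.quasiModularForms k
    change g ∈ ⨆ k, A.quasiModularForms k at hg
    clear hf'
    induction hf using Submodule.iSup_induction' with
    | zero => rw [zero_smul]; exact Submodule.zero_mem _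
    | add a b _ _ ha hb => rw [add_smul]; exact Submodule.add_mem _ ha hb
    | mem k f hf =>
      induction hg using Submodule.iSup_induction' with
      | zero => rw [smul_zero]; exact Submodule.zero_mem _
      | add a b _ _ ha hb => rw [smul_add]; exact Submodule.add_mem _ ha hb
      | mem l g hg => exact Submodule.mem_iSup_of_mem (k + l) (A.smul_mem_quasiModularForms hf hg)

instance : AddCommGroup (quasiModularAlgebra ⊗[ℂ] V) := TensorProduct.addCommGroup

instance : AddCommGroup (modularAlgebra ⊗[ℂ] V) := TensorProduct.addCommGroup

/-- The operator `f ⊗ L(1)` on `Q ⊗ V`, for `f` in `Q`. -/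
def mulL1 (f : quasiModularAlgebra) :
    Module.End quasiModularAlgebra (quasiModularAlgebra ⊗[ℂ] V) :=
  TensorProduct.AlgebraTensorModule.map (LinearMap.mulLeft quasiModularAlgebra f) A.L1

lemma mulL1_pow_tmul (f g : quasiModularAlgebra) (v : V) (n : ℕ) :
    (A.mulL1 f ^ n) (g ⊗ₜ[ℂ] v) = (f ^ n * g) ⊗ₜ[ℂ] ((A.L1 ^ n) v) := by
  induction n with
  | zero => simp
  | succ n ih =>
    rw [pow_succ', Module.End.mul_apply, ih, pow_succ', pow_succ', Module.End.mul_apply, mul_assoc]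
    rfl

lemma mulL1_locNilpotent (f : quasiModularAlgebra) : IsLocNilpotent (A.mulL1 f) := by
  intro x
  induction x using TensorProduct.induction_on with
  | zero => exact ⟨0, by simp⟩
  | tmul g v =>
    obtain ⟨n, hn⟩ := A.L1_locNilpotent v
    exact ⟨n, by rw [mulL1_pow_tmul, hn, tmul_zero]⟩
  | add x y hx hy =>
    obtain ⟨n, hn⟩ := hx
    obtain ⟨m, hm⟩ := hy
    exact ⟨n + m, by rw [map_add, pow_apply_eq_zero_of_le (Nat.le_add_right n m) hn,
      pow_apply_eq_zero_of_le (Nat.le_add_left m n) hm, add_zero]⟩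

/-- The operator `P = exp(-(2πi / 12) E₂ ⊗ L(1))` on `Q ⊗ V`, as a `Q`-linear automorphism. -/
def P : (quasiModularAlgebra ⊗[ℂ] V) ≃ₗ[quasiModularAlgebra] (quasiModularAlgebra ⊗[ℂ] V) :=
  locExpEquiv (A.mulL1 (-(2 * Real.pi * Complex.I / 12 : ℂ) • E2)) (A.mulL1_locNilpotent _)

end QVOA

/-- The inclusion `M ⊗ V ⊆ Q ⊗ V`. -/
def tensorInclusion (V : Type*) [AddCommGroup V] [Module ℂ V] :
    (modularAlgebra ⊗[ℂ] V) →ₗ[ℂ] (quasiModularAlgebra ⊗[ℂ] V) :=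
  TensorProduct.map (Subalgebra.inclusion modularAlgebra_le).toLinearMap LinearMap.id

end

/-! Every `V`-valued function is expanded in a homogeneous basis `b_i` of `V`. On `V_n` the inverse
cocycle is `K(γ, τ)⁻¹ = j ^ (2 n) exp(X(γ, τ) L(1))` (`QVOA.K_symm_apply`), so for
`f = ∑ i, f_i b_i` the slash operator of weight `k` is `exp(X L(1)) ∑ i, (f_i ∣[k - 2 deg b_i] γ) b_i`
(`QVOA.slash_eq_expL1_sum`). Since `exp(± X L(1))` is a polynomial in `X` on each `F_N V`, a
function is quasi-modular of weight `k` exactly when its coordinates `f_i` are quasi-modular of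
weight `k - 2 deg b_i`. This gives the isomorphism `ι`, and it reduces the directness of the
sums to the linear independence of scalar quasi-modular forms of different weights. That in turn
holds because `c ^ n j ^ (k - n)` are independent functions of the lower row of `γ`
(`coeff_zero_of_forall_slash_sum_eq_zero`).

The anomaly `E₂ ∣[2] γ = E₂ + (12 / 2πi) X` shows that `exp(-(2πi / 12) E₂ L(1)) v` is invariant
of weight `2 n` for `v` in `V_n` (`QVOA.modularLift_mem`): the anomaly cancels the factor
`exp(X L(1))`. Conversely, `exp((2πi / 12) E₂ L(1))` takes a modular form of weight `k` to a
quasi-modular one whose coordinates are invariant, hence modular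
(`QVOA.exists_sum_of_mem_modularForms`). So `ι ∘ P` maps `M ⊗ V` onto `M(V)`, respecting the
gradings.

The dimension formula counts the coordinates of an element of `M_k(V)`. Its range of summation
requires `V_n = 0` for `n < 0`; for CFT type this follows from the `𝔰𝔩₂` action, as `L(-1)`
kills the vacuum (`QVOA.gr_eq_bot_of_neg`). -/

/-! ### The vacuum and the vanishing of negative weight spaces -/

namespace QVOA

variable {V : Type*} [AddCommGroup V] [Module ℂ V] (A : QVOA V)

/-- The vacuum axiom `𝟏(-1) = id`, which the definition of a vertex algebra leaves implicit: it is
the Jacobi identity for `a`, `𝟏`, `𝟏` with `(r, s, t) = (-1, -1, 0)`. -/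
lemma mode_vacuum_neg_one (a : V) : A.mode A.vacuum (-1) a = a := by
  have h := A.jacobi a A.vacuum A.vacuum (-1) (-1) 0
  have hl : ∀ i : ℕ, (A.Y a).ncoeff (0 + (i : ℤ)) A.vacuum = 0 := fun i =>
    A.creative a _ (by positivity)
  simp only [hl, map_zero, Pi.zero_apply, LinearMap.zero_apply, smul_zero, finsum_zero] at h
  rw [finsum_eq_single _ 0] at h
  · simp only [pow_zero, Nat.cast_zero, sub_zero, add_zero, Ring.choose_zero_right,
      one_smul, A.creates, Int.negOnePow_zero, Units.val_one, mul_one] at h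
    exact (sub_eq_zero.mp h.symm).symm
  · intro i hi
    have : Ring.choose (0 : ℤ) i = 0 := by
      rw [Ring.choose_zero_pos ℤ (Nat.pos_of_ne_zero hi)]
    rw [this, mul_zero, zero_smul]

lemma derivation_vacuum : A.ρ sl2E A.vacuum = 0 := by
  have h := LinearMap.congr_fun (A.translation_comm A.vacuum (-1)) A.vacuum
  simp only [LinearMap.sub_apply, Module.End.mul_apply, LinearMap.smul_apply,
    mode_vacuum_neg_one] at h
  rw [sub_self, show (-1 : ℤ) - 1 = -2 by norm_num, ← A.derivation] at h
  simpa using h.symm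

section Bracket

attribute [local instance] LieRing.ofAssociativeRing LieAlgebra.ofAssociativeAlgebra

lemma L1_derivation (v : V) :
    A.L1 (A.ρ sl2E v) = A.ρ sl2E (A.L1 v) + (2 : ℂ) • A.L0 v := by
  have h : ⁅sl2F, sl2E⁆ = (2 : ℂ) • sl2H := by
    apply Subtype.ext
    rw [LieAlgebra.SpecialLinear.sl_bracket]
    ext i j
    fin_cases i <;> fin_cases j <;> (simp [sl2H, sl2E, sl2F]; try norm_num)
  have h2 := congrArg (fun T : Module.End ℂ V => T v) (A.ρ.map_lie sl2F sl2E)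
  simp only [h, map_smul] at h2
  have h3 : (2 : ℂ) • A.L0 v = A.L1 (A.ρ sl2E v) - A.ρ sl2E (A.L1 v) := h2
  rw [h3]
  abel

end Bracket

/-- The ladder relation `L(1) L(-1) ^ (m + 1) v = (m + 1) (2 k + m) L(-1) ^ m v` for a lowest
weight vector `v` of weight `k`. -/
lemma L1_derivation_pow (hv : A.vacuum ∈ A.gr 0) {k : ℤ} {v : V} (hk : v ∈ A.gr k)
    (h1 : A.L1 v = 0) (m : ℕ) : (A.ρ sl2E ^ m) v ∈ A.gr (k + m) ∧
      A.L1 ((A.ρ sl2E ^ (m + 1)) v) =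
        ((m + 1 : ℂ) * (2 * k + m)) • (A.ρ sl2E ^ m) v := by
  induction m with
  | zero =>
    refine ⟨by simpa using hk, ?_⟩
    have h0 : A.L0 v = (k : ℂ) • v := A.euler k v hk
    simp [L1_derivation, h1, h0, smul_smul]
  | succ m ih =>
    obtain ⟨ih1, ih2⟩ := ih
    have hmem : (A.ρ sl2E ^ (m + 1)) v ∈ A.gr (k + (m + 1 : ℕ)) := by
      rw [pow_succ', Module.End.mul_apply, A.derivation]
      convert! A.mode_mem _ _ (-2) _ ih1 _ hv using 2
      push_cast
      ring
    refine ⟨hmem, ?_⟩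
    have h0 := A.euler _ _ hmem
    change A.L0 _ = _ at h0
    rw [pow_succ' _ (m + 1), Module.End.mul_apply, L1_derivation, ih2, h0, map_smul,
      ← Module.End.mul_apply, ← pow_succ', smul_smul, ← add_smul]
    congr 1
    push_cast
    ring

/-- In a quasi-vertex operator algebra of CFT type the weights are nonnegative. A nonzero vector `v`
of minimal weight `k < 0` would be a lowest weight vector for `𝔰𝔩₂`; then `L(-1) ^ (-k) v` is a
multiple of the vacuum, which `L(-1)` kills, while `L(-1) ^ m v = 0` is impossible for
`m ≤ -2 k`. -/
lemma gr_eq_bot_of_neg (hA : A.IsCFTType) {k : ℤ} (hk : k < 0) : A.gr k = ⊥ := by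
  have hv : A.vacuum ∈ A.gr 0 := by
    rw [hA]
    exact Submodule.mem_span_singleton_self _
  obtain ⟨N, hN⟩ := A.bounded
  suffices H : ∀ m : ℕ, ∀ k < N + m, k < 0 → A.gr k = ⊥ from
    H (k - N + 1).toNat k (by have := Int.self_le_toNat (k - N + 1); omega) hk
  intro m
  induction m with
  | zero => exact fun k hk _ => hN k (by simpa using hk)
  | succ m ih =>
    intro k hkm hk
    rw [Submodule.eq_bot_iff]
    intro v hvk
    have h1 : A.L1 v = 0 := by
      have h := A.L1_mem hvk
      rwa [ih (k - 1) (by push_cast at hkm; omega) (by omega), Submodule.mem_bot] at h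
    have htop : (A.ρ sl2E ^ ((-k).toNat + 1)) v = 0 := by
      have h := (A.L1_derivation_pow hv hvk h1 (-k).toNat).1
      rw [show k + ((-k).toNat : ℤ) = 0 by omega, hA, Submodule.mem_span_singleton] at h
      obtain ⟨c, hc⟩ := h
      rw [pow_succ', Module.End.mul_apply, ← hc, map_smul, derivation_vacuum, smul_zero]
    have hdown : ∀ n : ℕ, (n : ℤ) ≤ -k + 1 → (A.ρ sl2E ^ n) v = 0 → v = 0 := by
      intro n
      induction n with
      | zero => exact fun _ h => by simpa using h
      | succ n ihn =>
        intro hn h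
        refine ihn (by push_cast at hn; omega) ?_
        have h2 := (A.L1_derivation_pow hv hvk h1 n).2
        rw [h, map_zero] at h2
        refine (smul_eq_zero.mp h2.symm).resolve_left (mul_ne_zero n.cast_add_one_ne_zero ?_)
        have : (2 * k + n : ℤ) ≠ 0 := by push_cast at hn; omega
        exact_mod_cast this
    exact hdown _ (by push_cast; omega) htop

/-! ### The exponential of `L(1)` -/

/-- The operator `exp(z L(1))` on the Fock space. -/
noncomputable def expL1 (z : ℂ) : Module.End ℂ V :=
  locExp (z • A.L1) (A.L1_locNilpotent.smul z)

lemma expL1_apply {n : ℕ} {v : V} (hn : (A.L1 ^ n) v = 0) (z : ℂ) :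
    A.expL1 z v = ∑ i ∈ Finset.range n, (z ^ i * (i.factorial : ℂ)⁻¹) • (A.L1 ^ i) v := by
  rw [expL1, locExp_apply_of_pow_eq_zero (n := n) _
    (by rw [smul_pow, LinearMap.smul_apply, hn, smul_zero])]
  refine Finset.sum_congr rfl fun i _ => ?_
  rw [smul_pow, LinearMap.smul_apply, smul_smul, mul_comm]
  simp

lemma expL1_add (z w : ℂ) (v : V) : A.expL1 (z + w) v = A.expL1 z (A.expL1 w v) := by
  obtain ⟨n, hn⟩ := A.L1_locNilpotent v
  have hn' : ∀ i, (A.L1 ^ n) ((A.L1 ^ i) v) = 0 := fun i => by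
    rw [← Module.End.mul_apply, ← pow_add]
    exact pow_apply_eq_zero_of_le (Nat.le_add_right n i) hn
  have hmap : ∀ p ∈ Finset.range n ×ˢ Finset.range n, p.1 + p.2 ∈ Finset.range (2 * n) := by
    intro p hp
    simp only [Finset.mem_product, Finset.mem_range] at hp ⊢
    omega
  rw [A.expL1_apply hn w, map_sum,
    A.expL1_apply (pow_apply_eq_zero_of_le (by omega : n ≤ 2 * n) hn), add_comm z w]
  simp only [map_smul, A.expL1_apply (hn' _) z, Finset.smul_sum, smul_smul]
  rw [← Finset.sum_product', ← Finset.sum_fiberwise_of_maps_to hmap]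
  refine Finset.sum_congr rfl fun m _ => ?_
  rw [(Commute.all w z).add_pow', Finset.sum_mul, Finset.sum_smul]
  symm
  refine Finset.sum_subset_zero_on_sdiff ?_ ?_ ?_
  · intro p hp
    exact Finset.HasAntidiagonal.mem_antidiagonal.mpr (Finset.mem_filter.mp hp).2
  · intro p hp
    simp only [Finset.mem_sdiff, Finset.mem_filter, Finset.mem_product,
      Finset.HasAntidiagonal.mem_antidiagonal, Finset.mem_range] at hp
    rw [pow_apply_eq_zero_of_le (n := n) (by omega) hn, smul_zero]
  · intro p hp
    obtain rfl := (Finset.mem_filter.mp hp).2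
    rw [← Module.End.mul_apply, ← pow_add, add_comm p.2 p.1]
    congr 1
    have h1 : (((p.1 + p.2).choose p.1 : ℂ)) * p.1.factorial * p.2.factorial =
        (p.1 + p.2).factorial := by
      have h := Nat.add_choose_mul_factorial_mul_factorial p.2 p.1
      rw [add_comm p.2 p.1, mul_right_comm] at h
      exact_mod_cast h
    have f1 : (p.1.factorial : ℂ) ≠ 0 := by exact_mod_cast p.1.factorial_ne_zero
    have f2 : (p.2.factorial : ℂ) ≠ 0 := by exact_mod_cast p.2.factorial_ne_zero
    have f3 : ((p.1 + p.2).factorial : ℂ) ≠ 0 := by exact_mod_cast (p.1 + p.2).factorial_ne_zero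
    rw [nsmul_eq_mul]
    field_simp
    rw [← h1]
    ring

lemma expL1_zero (v : V) : A.expL1 0 v = v := by
  obtain ⟨n, hn⟩ := A.L1_locNilpotent v
  rw [A.expL1_apply (pow_apply_eq_zero_of_le n.le_succ hn), Finset.sum_range_succ']
  simp

lemma expL1_neg_expL1 (z : ℂ) (v : V) : A.expL1 (-z) (A.expL1 z v) = v := by
  rw [← expL1_add, neg_add_cancel, expL1_zero]

lemma expL1_expL1_neg (z : ℂ) (v : V) : A.expL1 z (A.expL1 (-z) v) = v := by
  rw [← expL1_add, add_neg_cancel, expL1_zero]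

lemma K_apply (γ : SL(2, ℤ)) (τ : ℍ) (v : V) : A.K γ τ v =
    A.expL1 (-(γ 1 0 : ℂ) * autFactor γ τ) (A.powL0 (autFactor γ τ ^ (-2 : ℤ)) v) := rfl

/-- On `V_n` the cocycle satisfies `K(γ, τ)⁻¹ = j ^ (2 n) exp(X(γ, τ) L(1))`. -/
lemma K_symm_apply (γ : SL(2, ℤ)) (τ : ℍ) {n : ℤ} {v : V} (hv : v ∈ A.gr n) :
    (A.K γ τ).symm v = (autFactor γ τ : ℂ) ^ (2 * n) • A.expL1 (cuspX γ τ) v := by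
  rw [LinearEquiv.symm_apply_eq, map_smul, K_apply]
  have hj : (autFactor γ τ : ℂ) ≠ 0 := (autFactor γ τ).ne_zero
  have key : A.powL0 (autFactor γ τ ^ (-2 : ℤ)) (A.expL1 (cuspX γ τ) v) =
      (autFactor γ τ : ℂ) ^ (-(2 * n)) • A.expL1 ((γ 1 0 : ℂ) * autFactor γ τ) v := by
    obtain ⟨m, hm⟩ := A.L1_locNilpotent v
    rw [A.expL1_apply hm, A.expL1_apply hm, map_sum, Finset.smul_sum]
    refine Finset.sum_congr rfl fun i _ => ?_
    rw [map_smul, A.powL0_of_mem _ (A.L1_pow_mem hv i), smul_smul, smul_smul]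
    congr 1
    rw [Units.val_zpow_eq_zpow_val, ← zpow_mul,
      show (-2 : ℤ) * (n - i) = -(2 * n) + i + i by ring, zpow_add₀ hj, zpow_add₀ hj, cuspX,
      zpow_natCast, mul_pow, div_pow]
    field_simp
  rw [key, map_smul, neg_mul, expL1_neg_expL1, smul_smul, ← zpow_add₀ hj, add_neg_cancel, zpow_zero,
    one_smul]

lemma slash_const {n : ℤ} {v : V} (hv : v ∈ A.gr n) (γ : SL(2, ℤ)) (τ : ℍ) :
    A.slash (2 * n) γ (fun _ => v) τ = A.expL1 (cuspX γ τ) v := by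
  rw [slash, K_symm_apply A γ τ hv, smul_smul, ← zpow_add₀ (autFactor γ τ).ne_zero, neg_add_cancel,
    zpow_zero, one_smul]

end QVOA

/-! ### Scalar-valued forms -/

/-- A function that is holomorphic, holomorphic at the cusp and invariant under all of `SL₂(ℤ)` is
a modular form: its `q`-expansion bounds it at `i∞`, hence by invariance at every cusp. -/
lemma mem_modularFormSpace_of_slash_eq {k : ℤ} {f : ℍ → ℂ}
    (hf : f ∈ holomorphicForms (⊤ : Submodule ℂ ℂ)) (h : ∀ γ : SL(2, ℤ), f ∣[k] γ = f) :
    f ∈ modularFormSpace k := by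
  obtain ⟨-, hd, a, -, ha⟩ := hf
  have hb : IsBoundedAtImInfty f := by
    refine isBoundedAtImInfty_of_hasSum_qExpansion (c := a) one_pos fun τ => ?_
    convert! ha LinearMap.id τ using 1
    ext n
    simp [Function.Periodic.qParam, qVar]
  refine ⟨⟨⟨f, ?_⟩, hd LinearMap.id, ?_⟩, rfl⟩
  · rintro _ ⟨γ, rfl⟩
    exact h γ
  · intro c hc
    rw [OnePoint.isBoundedAt_iff_forall_SL2Z hc]
    intro γ _
    change IsBoundedAtImInfty (f ∣[k] γ)
    rw [h γ]
    exact hb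

/-- The modular forms of weight `k` as elements of Mathlib's space and as functions. -/
noncomputable def modularFormSpaceEquiv (k : ℤ) : ModularForm 𝒮ℒ k ≃ₗ[ℂ] modularFormSpace k :=
  LinearEquiv.ofBijective
    { toFun := fun f => ⟨f, f, rfl⟩
      map_add' := fun _ _ => rfl
      map_smul' := fun _ _ => rfl }
    ⟨fun f g h => DFunLike.coe_injective (congrArg Subtype.val h), by
      rintro ⟨_, f, rfl⟩
      exact ⟨f, rfl⟩⟩

instance (k : ℤ) : FiniteDimensional ℂ (modularFormSpace k) :=
  (modularFormSpaceEquiv k).finiteDimensional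

lemma modularFormSpace_eq_bot {k : ℤ} (hk : Odd k ∨ k < 0) : modularFormSpace k = ⊥ := by
  rw [Submodule.eq_bot_iff]
  rintro _ ⟨f, rfl⟩
  rcases hk with hk | hk
  · rw [ModularForm.levelOne_odd_weight_eq_zero hk f]; rfl
  · exact ModularFormClass.levelOne_neg_weight_eq_zero hk f

lemma E2_slash (γ : SL(2, ℤ)) (τ : ℍ) :
    (autFactor γ τ : ℂ) ^ (-2 : ℤ) * EisensteinSeries.E2 (γ • τ) =
      EisensteinSeries.E2 τ + 12 / (2 * Real.pi * Complex.I) * cuspX γ τ := by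
  have h := congrFun (EisensteinSeries.E2_slash_action γ) τ
  rw [ModularForm.SL_slash_apply] at h
  simp only [Pi.sub_apply, Pi.smul_apply, EisensteinSeries.D2, riemannZeta_two, smul_eq_mul] at h
  simp only [cuspX, autFactor, Units.val_mk0]
  rw [mul_comm, h]
  have h1 := denom_ne_zero γ τ
  have h2 : (Real.pi : ℂ) ≠ 0 := by exact_mod_cast Real.pi_ne_zero
  have h3 := Complex.I_ne_zero
  have h4 := Complex.I_sq
  field_simp
  linear_combination (-12 * ((γ 1 0 : ℤ) : ℂ)) * h4

/-- The matrix `(1 t; c 1 + c t)`. For fixed `c ≠ 0` these realise infinitely many automorphy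
factors with lower left entry `c`. -/
def lowerRowMatrix (c t : ℤ) : SL(2, ℤ) :=
  ⟨!![1, t; c, 1 + c * t], by rw [Matrix.det_fin_two_of]; ring⟩

lemma autFactor_lowerRowMatrix (c t : ℤ) (τ : ℍ) :
    (autFactor (lowerRowMatrix c t) τ : ℂ) = c * τ + (1 + c * t) := by
  rw [autFactor, Units.val_mk0, ModularGroup.denom_apply]
  simp [lowerRowMatrix]

lemma cuspX_lowerRowMatrix (c t : ℤ) (τ : ℍ) :
    cuspX (lowerRowMatrix c t) τ = c / (autFactor (lowerRowMatrix c t) τ : ℂ) := by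
  simp [cuspX, lowerRowMatrix]

/-- A linear combination of the functions `c ^ n j ^ (k - n)`, with `j = j(γ, τ)` and `c` the lower
left entry of `γ`, vanishes for all `γ` only if its coefficients at `n = 0` are zero: for fixed
`c ≠ 0` it is a Laurent polynomial in `j` with infinitely many zeros, and each coefficient of that
Laurent polynomial is a polynomial in `c` with infinitely many zeros. -/
lemma coeff_zero_of_forall_slash_sum_eq_zero (τ : ℍ) (S : Finset ℤ) (s : ℕ) (q : ℤ → ℕ → ℂ)
    (h : ∀ γ : SL(2, ℤ), ∑ k ∈ S, (autFactor γ τ : ℂ) ^ k *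
      ∑ n ∈ Finset.range (s + 1), cuspX γ τ ^ n * q k n = 0) {k : ℤ} (hk : k ∈ S) : q k 0 = 0 := by
  classical
  obtain ⟨L, hL⟩ : ∃ L : ℕ, ∀ k ∈ S, -k ≤ L := by
    refine ⟨∑ k ∈ S, k.natAbs, fun k hk => ?_⟩
    have := Finset.single_le_sum (f := fun k : ℤ => k.natAbs) (fun _ _ => Nat.zero_le _) hk
    omega
  -- the exponent of `j` after clearing denominators
  let e : ℤ → ℕ → ℕ := fun k n => (k - n + L + s).toNat
  have he : ∀ k ∈ S, ∀ n ∈ Finset.range (s + 1), (e k n : ℤ) = k - n + L + s := by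
    intro k hk n hn
    have := hL k hk
    rw [Finset.mem_range] at hn
    simp only [e]
    omega
  have h1 : ∀ c : ℤ, c ≠ 0 → (∑ k ∈ S, ∑ n ∈ Finset.range (s + 1),
      Polynomial.monomial (e k n) ((c : ℂ) ^ n * q k n)) = 0 := by
    intro c hc
    have hc' : (c : ℂ) ≠ 0 := by exact_mod_cast hc
    refine Polynomial.eq_zero_of_infinite_isRoot _ ?_
    refine Set.infinite_of_injective_forall_mem (f := fun t : ℤ => (c * τ + (1 + c * t) : ℂ)) ?_ ?_
    · intro t t' ht
      simpa [hc'] using ht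
    · intro t
      have ht := h (lowerRowMatrix c t)
      simp only [cuspX_lowerRowMatrix] at ht
      have hj := (autFactor (lowerRowMatrix c t) τ).ne_zero
      rw [← autFactor_lowerRowMatrix]
      generalize ((autFactor (lowerRowMatrix c t) τ : ℂˣ) : ℂ) = j at ht hj ⊢
      rw [Set.mem_ofPred_eq, Polynomial.IsRoot.def, Polynomial.eval_finsetSum]
      simp only [Polynomial.eval_finsetSum, Polynomial.eval_monomial]
      have h2 := congrArg (fun x => j ^ (L + s) * x) ht
      simp only [mul_zero, Finset.mul_sum] at h2
      rw [← h2]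
      refine Finset.sum_congr rfl fun k hk => Finset.sum_congr rfl fun n hn => ?_
      have h3 : j ^ (e k n) = j ^ (L + s) * j ^ k * (j ^ n)⁻¹ := by
        rw [← zpow_natCast, he k hk n hn, show k - n + L + s = (L + s : ℕ) + k + (-n : ℤ) by
          push_cast; ring, zpow_add₀ hj, zpow_add₀ hj, zpow_neg, zpow_natCast, zpow_natCast]
      rw [h3, div_pow]
      ring
  have h2 : (∑ l ∈ S, ∑ n ∈ Finset.range (s + 1),
      if e l n = e k 0 then Polynomial.monomial n (q l n) else 0) = 0 := by
    refine Polynomial.eq_zero_of_infinite_isRoot _ ?_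
    refine Set.infinite_of_injective_forall_mem (f := fun c : ℕ => ((c : ℂ) + 1)) ?_ ?_
    · intro c c' hc
      simpa using hc
    · intro c
      have hc := congrArg (fun p => Polynomial.coeff p (e k 0)) (h1 (c + 1) (by positivity))
      simp only [Polynomial.finsetSum_coeff, Polynomial.coeff_monomial, Polynomial.coeff_zero] at hc
      rw [Set.mem_ofPred_eq, Polynomial.IsRoot.def, Polynomial.eval_finsetSum, ← hc]
      simp only [Polynomial.eval_finsetSum]
      refine Finset.sum_congr rfl fun l _ => Finset.sum_congr rfl fun n _ => ?_
      split_ifs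
      · rw [Polynomial.eval_monomial, mul_comm]
        push_cast
        rfl
      · simp
  have h3 := congrArg (fun p => Polynomial.coeff p 0) h2
  simp only [Polynomial.finsetSum_coeff, Polynomial.coeff_zero] at h3
  rw [Finset.sum_eq_single k, Finset.sum_eq_single 0] at h3
  · simpa using h3
  · intro n _ hn
    split_ifs
    · rw [Polynomial.coeff_monomial, if_neg hn]
    · simp
  · simp
  · intro l hl hlk
    refine Finset.sum_eq_zero fun n hn => ?_
    split_ifs with hln
    · rw [Polynomial.coeff_monomial, if_neg]
      rintro rfl
      have e1 := he l hl 0 hn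
      have e2 := he k hk 0 hn
      rw [hln] at e1
      omega
    · simp
  · exact fun h => absurd hk h

/-- Quasi-modular forms of different weights are linearly independent. -/
lemma iSupIndep_quasiModularFormSpace : iSupIndep quasiModularFormSpace := by
  classical
  rw [iSupIndep_iff_finsetSum_eq_zero_imp_eq_zero]
  intro S f hf hsum k hk
  choose! d q _ hq using fun l (hl : l ∈ S) => (hf l hl).2
  let s := S.sup d
  have hd : ∀ l ∈ S, d l ≤ s := fun l hl => Finset.le_sup hl
  -- the expansions of all `f l`, padded by zeros to the common length `s + 1`
  let r : ℍ → ℤ → ℕ → ℂ := fun τ l n => if n ≤ d l then q l n τ else 0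
  have hr : ∀ l ∈ S, ∀ γ τ, (f l ∣[l] γ) τ =
      ∑ n ∈ Finset.range (s + 1), cuspX γ τ ^ n * r τ l n := by
    intro l hl γ τ
    refine (hq l hl γ τ).trans ?_
    refine Finset.sum_subset_zero_on_sdiff
      (Finset.range_subset_range.mpr (Nat.succ_le_succ (hd l hl))) (fun n hn => ?_) fun n hn => ?_
    · simp only [Finset.mem_sdiff, Finset.mem_range] at hn
      simp only [r]
      rw [if_neg (by omega), mul_zero]
    · rw [Finset.mem_range] at hn
      simp only [r]
      rw [if_pos (by omega), smul_eq_mul]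
  ext τ
  have h0 := coeff_zero_of_forall_slash_sum_eq_zero τ S s (r τ) (fun γ => ?_) hk
  · have h1 := hr k hk 1 τ
    rw [SlashAction.slash_one, Finset.sum_range_succ'] at h1
    simpa [cuspX, h0] using h1
  · have h2 := congrFun hsum (γ • τ)
    rw [Finset.sum_apply, Pi.zero_apply] at h2
    rw [← h2]
    refine Finset.sum_congr rfl fun l hl => ?_
    have hj : denom γ τ ≠ 0 := denom_ne_zero γ τ
    rw [← hr l hl, ModularForm.SL_slash_apply, autFactor, Units.val_mk0, mul_left_comm,
      ← zpow_add₀ hj, add_neg_cancel, zpow_zero, mul_one]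

/-! ### Operations on quasi-modular expansions -/

section Expansions

variable {U : Type*} [AddCommGroup U] [Module ℂ U]

lemma map_mem_holomorphicForms {W : Submodule ℂ U} {U' : Type*} [AddCommGroup U'] [Module ℂ U']
    {W' : Submodule ℂ U'} (T : U →ₗ[ℂ] U') (hT : ∀ w ∈ W, T w ∈ W') {f : ℍ → U}
    (hf : f ∈ holomorphicForms W) : (fun τ => T (f τ)) ∈ holomorphicForms W' := by
  obtain ⟨hf, hf', a, ha, ha'⟩ := hf
  exact ⟨fun τ => hT _ (hf τ), fun φ => hf' (φ ∘ₗ T), fun n => T (a n), fun n => hT _ (ha n),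
    fun φ τ => ha' (φ ∘ₗ T) τ⟩

lemma HasQuasiExpansion.map {W : Submodule ℂ U} {U' : Type*} [AddCommGroup U'] [Module ℂ U']
    {W' : Submodule ℂ U'} (T : U →ₗ[ℂ] U') (hT : ∀ w ∈ W, T w ∈ W') {F : SL(2, ℤ) → ℍ → U}
    (hF : HasQuasiExpansion (holomorphicForms W) F) :
    HasQuasiExpansion (holomorphicForms W') fun γ τ => T (F γ τ) := by
  obtain ⟨s, Q, hQ, hF⟩ := hF
  exact ⟨s, fun n τ => T (Q n τ), fun n => map_mem_holomorphicForms T hT (hQ n), fun γ τ => by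
    simp only [hF, map_sum, map_smul]⟩

lemma HasQuasiExpansion.sum {B : Submodule ℂ (ℍ → U)} {ι : Type*} (S : Finset ι)
    {F : ι → SL(2, ℤ) → ℍ → U} (hF : ∀ i ∈ S, HasQuasiExpansion B (F i)) :
    HasQuasiExpansion B (∑ i ∈ S, F i) :=
  Finset.sum_induction _ (HasQuasiExpansion B) (fun _ _ => HasQuasiExpansion.add)
    (HasQuasiExpansion.zero B) hF

lemma HasQuasiExpansion.const {B : Submodule ℂ (ℍ → U)} {f : ℍ → U} (hf : f ∈ B) :
    HasQuasiExpansion B fun _ => f :=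
  ⟨0, fun _ => f, fun _ => hf, fun γ τ => by simp⟩

lemma hasQuasiExpansion_cuspX_pow (m : ℕ) :
    HasQuasiExpansion (holomorphicForms (⊤ : Submodule ℂ ℂ)) fun γ τ => cuspX γ τ ^ m := by
  refine ⟨m, fun n _ => if n = m then 1 else 0, fun n => const_mem_holomorphicForms _ trivial,
    fun γ τ => ?_⟩
  simp

end Expansions

/-! ### Homogeneous coordinates on the Fock space -/

namespace QVOA

variable {V : Type*} [AddCommGroup V] [Module ℂ V] (A : QVOA V)

/-- The index set of a homogeneous basis: a weight `n` and the number of a basis vector of `V_n`. -/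
abbrev Index : Type := Σ n : ℤ, Fin (Module.finrank ℂ (A.gr n))

/-- A basis of the Fock space consisting of homogeneous vectors. -/
noncomputable def homogeneousBasis : Module.Basis A.Index ℂ V :=
  A.isInternal.collectedBasis fun n =>
    letI := A.finiteDimensional n
    Module.finBasis ℂ (A.gr n)

lemma homogeneousBasis_mem (i : A.Index) : A.homogeneousBasis i ∈ A.gr i.1 :=
  A.isInternal.collectedBasis_mem _ i

lemma repr_eq_zero_of_mem_trunc {N : ℤ} {v : V} (hv : v ∈ A.trunc N) {i : A.Index}
    (hi : N < i.1) : A.homogeneousBasis.repr v i = 0 := by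
  have h : A.trunc N ≤ LinearMap.ker (A.homogeneousBasis.coord i) := by
    refine iSup₂_le fun n hn v hv => ?_
    rw [LinearMap.mem_ker, Module.Basis.coord_apply]
    exact A.isInternal.collectedBasis_repr_of_mem_ne _ (lt_of_le_of_lt hn hi).ne hv
  exact h hv

lemma exists_finset_index (N : ℤ) : ∃ T : Finset A.Index, ∀ i : A.Index, i.1 ≤ N → i ∈ T := by
  obtain ⟨N₀, hN₀⟩ := A.bounded
  refine ⟨(Finset.Icc N₀ N).sigma fun _ => Finset.univ, fun i hi => ?_⟩
  simp only [Finset.mem_sigma, Finset.mem_Icc, Finset.mem_univ, and_true]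
  refine ⟨?_, hi⟩
  by_contra! h
  obtain ⟨n, a⟩ := i
  have ha := a.2
  have h0 : Module.finrank ℂ (A.gr n) = 0 := by rw [hN₀ n h, finrank_bot]
  omega

lemma sum_repr_of_mem_trunc {N : ℤ} {T : Finset A.Index} (hT : ∀ i : A.Index, i.1 ≤ N → i ∈ T)
    {v : V} (hv : v ∈ A.trunc N) :
    ∑ i ∈ T, A.homogeneousBasis.repr v i • A.homogeneousBasis i = v := by
  conv_rhs => rw [← A.homogeneousBasis.linearCombination_repr v, Finsupp.linearCombination_apply]
  refine (Finsupp.sum_of_support_subset _ ?_ (fun i a => a • A.homogeneousBasis i)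
    fun i _ => zero_smul ℂ (A.homogeneousBasis i)).symm
  intro i hi
  by_contra h
  exact (Finsupp.mem_support_iff.mp hi)
    (A.repr_eq_zero_of_mem_trunc hv (not_le.mp fun h' => h (hT i h')))

lemma mem_trunc {n N : ℤ} (h : n ≤ N) {v : V} (hv : v ∈ A.gr n) : v ∈ A.trunc N :=
  Submodule.mem_iSup_of_mem n (Submodule.mem_iSup_of_mem h hv)

lemma L1_pow_mem_trunc {N : ℤ} (m : ℕ) {v : V} (hv : v ∈ A.trunc N) :
    (A.L1 ^ m) v ∈ A.trunc N := by
  have h : A.trunc N ≤ (A.trunc N).comap (A.L1 ^ m) :=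
    iSup₂_le fun n hn v hv => A.mem_trunc
      (le_trans (by simp) (Set.mem_Iic.mp hn) : n - m ≤ N) (A.L1_pow_mem hv m)
  exact h hv

lemma exists_L1_pow_trunc_eq_zero (N : ℤ) : ∃ M : ℕ, ∀ v ∈ A.trunc N, (A.L1 ^ M) v = 0 := by
  obtain ⟨N₀, hN₀⟩ := A.bounded
  refine ⟨(N - N₀ + 1).toNat, fun v hv => ?_⟩
  have h : A.trunc N ≤ LinearMap.ker (A.L1 ^ (N - N₀ + 1).toNat) := by
    refine iSup₂_le fun n hn v hv => ?_
    have h1 := A.L1_pow_mem hv (N - N₀ + 1).toNat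
    rw [Set.mem_Iic] at hn
    rwa [hN₀ _ (by omega), Submodule.mem_bot] at h1
  exact h hv

/-! ### Quasi-modular forms in coordinates -/

/-- Quasi-modular expansions are preserved by `exp(z X(γ, τ) L(1))`, a polynomial in `X(γ, τ)` of
bounded degree on each `F_N V`. -/
lemma hasQuasiExpansion_expL1 {N : ℤ} {F : SL(2, ℤ) → ℍ → V}
    (hF : HasQuasiExpansion (holomorphicForms (A.trunc N)) F) (z : ℂ) :
    HasQuasiExpansion (holomorphicForms (A.trunc N))
      fun γ τ => A.expL1 (z * cuspX γ τ) (F γ τ) := by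
  obtain ⟨M, hM⟩ := A.exists_L1_pow_trunc_eq_zero N
  have hmem : ∀ γ τ, F γ τ ∈ A.trunc N := by
    obtain ⟨s, Q, hQ, h⟩ := hF
    intro γ τ
    rw [h]
    exact Submodule.sum_mem _ fun n _ => Submodule.smul_mem _ _ ((hQ n).1 τ)
  have h : (fun γ τ => A.expL1 (z * cuspX γ τ) (F γ τ)) = ∑ m ∈ Finset.range M,
      (z ^ m * (m.factorial : ℂ)⁻¹) •
        fun γ => (fun τ => cuspX γ τ ^ m) • fun τ => (A.L1 ^ m) (F γ τ) := by
    ext γ τ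
    rw [A.expL1_apply (hM _ (hmem γ τ)), Finset.sum_apply, Finset.sum_apply]
    refine Finset.sum_congr rfl fun m _ => ?_
    simp only [Pi.smul_apply, Pi.smul_apply', smul_smul]
    congr 1
    ring
  rw [h]
  exact HasQuasiExpansion.sum _ fun m _ => ((hasQuasiExpansion_cuspX_pow m).mul
    (hF.map _ fun w hw => A.L1_pow_mem_trunc m hw)).smul _

lemma const_mem_quasiModularForms {n : ℤ} {v : V} (hv : v ∈ A.gr n) :
    (fun _ => v) ∈ A.quasiModularForms (2 * n) := by
  have hc := const_mem_holomorphicForms (A.trunc n) (A.mem_trunc le_rfl hv)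
  refine ⟨n, hc, ?_⟩
  convert! A.hasQuasiExpansion_expL1 (HasQuasiExpansion.const hc) 1 using 1
  ext γ τ
  rw [A.slash_const hv, one_mul]

/-- In homogeneous coordinates `f = ∑ i, f_i b_i` the slash operator of weight `k` is
`exp(X(γ, τ) L(1))` applied to the scalar slash operators of weight `k - 2 deg b_i`. -/
lemma slash_eq_expL1_sum (k : ℤ) (γ : SL(2, ℤ)) {N : ℤ} {T : Finset A.Index}
    (hT : ∀ i : A.Index, i.1 ≤ N → i ∈ T) {f : ℍ → V} (hf : ∀ τ, f τ ∈ A.trunc N) (τ : ℍ) :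
    A.slash k γ f τ = A.expL1 (cuspX γ τ) (∑ i ∈ T,
      ((fun τ => A.homogeneousBasis.repr (f τ) i) ∣[k - 2 * i.1] γ) τ •
        A.homogeneousBasis i) := by
  conv_lhs => rw [slash, ← A.sum_repr_of_mem_trunc hT (hf (γ • τ))]
  rw [map_sum, map_sum, Finset.smul_sum]
  refine Finset.sum_congr rfl fun i _ => ?_
  rw [map_smul, map_smul, A.K_symm_apply γ τ (A.homogeneousBasis_mem i), smul_smul, smul_smul,
    ModularForm.SL_slash_apply, autFactor, Units.val_mk0,
    show -(k - 2 * i.1) = -k + 2 * i.1 by ring, zpow_add₀ (denom_ne_zero γ τ)]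
  congr 1
  ring

/-- The coordinate of a `V`-valued quasi-modular form of weight `k` at a basis vector of weight `n`
is a quasi-modular form of weight `k - 2 n`. -/
lemma repr_mem_quasiModularFormSpace {k : ℤ} {f : ℍ → V} (hf : f ∈ A.quasiModularForms k)
    (i : A.Index) :
    (fun τ => A.homogeneousBasis.repr (f τ) i) ∈ quasiModularFormSpace (k - 2 * i.1) := by
  classical
  obtain ⟨N, hf, hq⟩ := hf
  obtain ⟨T, hT⟩ := A.exists_finset_index N
  refine ⟨map_mem_holomorphicForms (W' := ⊤) (A.homogeneousBasis.coord i)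
    (fun _ _ => trivial) hf, ?_⟩
  convert! (A.hasQuasiExpansion_expL1 hq (-1)).map (W' := ⊤) (A.homogeneousBasis.coord i)
    (fun _ _ => trivial) using 1
  ext γ τ
  rw [A.slash_eq_expL1_sum k γ (T := insert i T) (fun j hj => Finset.mem_insert_of_mem (hT j hj))
    hf.1, neg_one_mul, expL1_neg_expL1]
  simp [Finsupp.single_apply]

/-- A `V`-valued quasi-modular form of weight `k` is a finite sum `∑ i, f_i b_i` with quasi-modular
coefficients. -/
lemma exists_sum_of_mem_quasiModularForms {k : ℤ} {f : ℍ → V} (hf : f ∈ A.quasiModularForms k) :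
    ∃ (T : Finset A.Index) (g : A.Index → ℍ → ℂ),
      (∀ i, g i ∈ quasiModularFormSpace (k - 2 * i.1)) ∧
        ∀ τ, f τ = ∑ i ∈ T, g i τ • A.homogeneousBasis i := by
  have hf' := hf
  obtain ⟨N, hN, -⟩ := hf'
  obtain ⟨T, hT⟩ := A.exists_finset_index N
  exact ⟨T, fun i τ => A.homogeneousBasis.repr (f τ) i, A.repr_mem_quasiModularFormSpace hf,
    fun τ => (A.sum_repr_of_mem_trunc hT (hN.1 τ)).symm⟩

lemma iSupIndep_quasiModularForms : iSupIndep A.quasiModularForms := by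
  classical
  rw [iSupIndep_iff_finsetSum_eq_zero_imp_eq_zero]
  intro S f hf hsum k hk
  ext τ
  refine A.homogeneousBasis.ext_elem fun i => ?_
  have h := (iSupIndep_iff_finsetSum_eq_zero_imp_eq_zero _).mp
    (iSupIndep_quasiModularFormSpace.comp (f := fun l : ℤ => l - 2 * i.1)
      (fun a b h => by simpa using h))
    S (fun l τ => A.homogeneousBasis.repr (f l τ) i)
    (fun l hl => A.repr_mem_quasiModularFormSpace (hf l hl) i) ?_ k hk
  · simpa using congrFun h τ
  · ext σ
    have h1 := congrArg (fun v => A.homogeneousBasis.repr v i) (congrFun hsum σ)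
    simpa [Finset.sum_apply, Finsupp.finsetSum_apply] using h1

lemma modularForms_le_quasiModularForms (k : ℤ) : A.modularForms k ≤ A.quasiModularForms k := by
  rintro f ⟨⟨N, hf⟩, h⟩
  refine ⟨N, hf, ?_⟩
  simpa only [h] using! HasQuasiExpansion.const hf

lemma iSupIndep_modularForms : iSupIndep A.modularForms :=
  A.iSupIndep_quasiModularForms.mono A.modularForms_le_quasiModularForms

/-! ### Modular forms in coordinates -/

lemma slash_sum (k : ℤ) (γ : SL(2, ℤ)) {ι : Type*} (S : Finset ι) (F : ι → ℍ → V) :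
    A.slash k γ (∑ i ∈ S, F i) = ∑ i ∈ S, A.slash k γ (F i) :=
  map_sum (⟨⟨A.slash k γ, A.slash_zero k γ⟩, A.slash_add k γ⟩ : (ℍ → V) →+ (ℍ → V)) F S

lemma E2_pow_mem (m : ℕ) : EisensteinSeries.E2 ^ m ∈ quasiModularFormSpace (2 * m) := by
  have h := SetLike.pow_mem_graded m E2_mem
  rwa [nsmul_eq_mul, mul_comm] at h

lemma expL1_E2_mem_quasiModularForms {n : ℤ} {v : V} (hv : v ∈ A.gr n) (c : ℂ) :
    (fun τ => A.expL1 (c * EisensteinSeries.E2 τ) v) ∈ A.quasiModularForms (2 * n) := by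
  obtain ⟨M, hM⟩ := A.L1_locNilpotent v
  have h : (fun τ => A.expL1 (c * EisensteinSeries.E2 τ) v) = ∑ m ∈ Finset.range M,
      (c ^ m * (m.factorial : ℂ)⁻¹) •
        (EisensteinSeries.E2 ^ m • fun _ => (A.L1 ^ m) v : ℍ → V) := by
    ext τ
    rw [A.expL1_apply hM, Finset.sum_apply]
    refine Finset.sum_congr rfl fun m _ => ?_
    simp only [Pi.smul_apply, Pi.smul_apply', Pi.pow_apply, smul_smul]
    congr 1
    ring
  rw [h]
  refine Submodule.sum_mem _ fun m _ => Submodule.smul_mem _ _ ?_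
  have h1 := A.smul_mem_quasiModularForms (E2_pow_mem m)
    (A.const_mem_quasiModularForms (A.L1_pow_mem hv m))
  rwa [show (2 * m : ℤ) + 2 * (n - m) = 2 * n by ring] at h1

/-- The function `τ ↦ exp(-(2πi / 12) E₂(τ) L(1)) v`. -/
noncomputable def modularLift (v : V) (τ : ℍ) : V :=
  A.expL1 (-(2 * Real.pi * Complex.I / 12) * EisensteinSeries.E2 τ) v

/-- The function `exp(-(2πi / 12) E₂ L(1)) v` is modular: the anomaly of `E₂` under the slash
operator cancels the factor `exp(X(γ, τ) L(1))` of the cocycle. -/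
lemma modularLift_mem {n : ℤ} {v : V} (hv : v ∈ A.gr n) :
    A.modularLift v ∈ A.modularForms (2 * n) := by
  obtain ⟨N, hN, -⟩ := A.expL1_E2_mem_quasiModularForms hv (-(2 * Real.pi * Complex.I / 12))
  refine ⟨⟨N, hN⟩, fun γ => ?_⟩
  ext τ
  obtain ⟨M, hM⟩ := A.L1_locNilpotent v
  have hj := (autFactor γ τ).ne_zero
  have h : A.slash (2 * n) γ (A.modularLift v) τ = A.expL1 (cuspX γ τ)
      (A.expL1 (-(2 * Real.pi * Complex.I / 12) *
        ((autFactor γ τ : ℂ) ^ (-2 : ℤ) * EisensteinSeries.E2 (γ • τ))) v) := by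
    rw [slash, modularLift, A.expL1_apply hM, A.expL1_apply hM, map_sum, map_sum, Finset.smul_sum]
    refine Finset.sum_congr rfl fun m _ => ?_
    rw [map_smul, map_smul, A.K_symm_apply γ τ (A.L1_pow_mem hv m), smul_smul, smul_smul,
      show 2 * (n - m) = 2 * n + (-2) * (m : ℤ) by ring, zpow_add₀ hj,
      zpow_mul _ (-2) (m : ℤ), zpow_natCast, zpow_neg]
    congr 1
    have := zpow_ne_zero (2 * n) hj
    rw [mul_pow, mul_pow, mul_pow]
    field_simp
  rw [h, ← expL1_add, E2_slash, modularLift]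
  congr 2
  have h2 : (Real.pi : ℂ) ≠ 0 := by exact_mod_cast Real.pi_ne_zero
  have h3 := Complex.I_ne_zero
  field_simp
  ring

lemma expL1_modularLift (v : V) (τ : ℍ) :
    A.expL1 (2 * Real.pi * Complex.I / 12 * EisensteinSeries.E2 τ) (A.modularLift v τ) = v := by
  rw [modularLift, neg_mul, expL1_expL1_neg]

/-- A `V`-valued modular form of weight `k` is a finite sum `∑ i, g_i exp(-(2πi / 12) E₂ L(1)) b_i`
with modular coefficients: applying `exp((2πi / 12) E₂ L(1))` gives a quasi-modular form, whose
coordinates are invariant because the functions `exp(-(2πi / 12) E₂ L(1)) b_i` are. -/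
lemma exists_sum_of_mem_modularForms {k : ℤ} {f : ℍ → V} (hf : f ∈ A.modularForms k) :
    ∃ (T : Finset A.Index) (g : A.Index → ℍ → ℂ),
      (∀ i ∈ T, g i ∈ modularFormSpace (k - 2 * i.1)) ∧
        ∀ τ, f τ = ∑ i ∈ T, g i τ • A.modularLift (A.homogeneousBasis i) τ := by
  set c : ℂ := 2 * Real.pi * Complex.I / 12 with hc
  obtain ⟨T₀, g₀, hg₀, hf₀⟩ :=
    A.exists_sum_of_mem_quasiModularForms (A.modularForms_le_quasiModularForms k hf)
  have hh : (fun τ => A.expL1 (c * EisensteinSeries.E2 τ) (f τ)) ∈ A.quasiModularForms k := by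
    have h : (fun τ => A.expL1 (c * EisensteinSeries.E2 τ) (f τ)) = ∑ i ∈ T₀,
        g₀ i • fun τ => A.expL1 (c * EisensteinSeries.E2 τ) (A.homogeneousBasis i) := by
      ext τ
      rw [hf₀, map_sum, Finset.sum_apply]
      simp only [map_smul, Pi.smul_apply']
    rw [h]
    refine Submodule.sum_mem _ fun i _ => ?_
    have h1 := A.smul_mem_quasiModularForms (hg₀ i)
      (A.expL1_E2_mem_quasiModularForms (A.homogeneousBasis_mem i) c)
    rwa [sub_add_cancel] at h1
  obtain ⟨T, g, hg, hgf⟩ := A.exists_sum_of_mem_quasiModularForms hh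
  have hfg : f = ∑ i ∈ T, g i • A.modularLift (A.homogeneousBasis i) := by
    ext τ
    have h := congrArg (A.expL1 (-(c * EisensteinSeries.E2 τ))) (hgf τ)
    rw [expL1_neg_expL1, map_sum, ← neg_mul] at h
    simp only [map_smul] at h
    rw [h, Finset.sum_apply]
    rfl
  refine ⟨T, g, fun i hi => mem_modularFormSpace_of_slash_eq (hg i).1 fun γ => ?_, fun τ => by
    rw [hfg, Finset.sum_apply]; rfl⟩
  ext τ
  have hs := congrFun (hf.2 γ) τ
  have hs' : A.slash k γ f = ∑ i ∈ T,
      (g i ∣[k - 2 * i.1] γ) • A.modularLift (A.homogeneousBasis i) := by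
    rw [hfg, slash_sum]
    refine Finset.sum_congr rfl fun i _ => ?_
    have h1 := A.slash_mul (k - 2 * i.1) (2 * i.1) γ (g i) (A.modularLift (A.homogeneousBasis i))
    rwa [sub_add_cancel, (A.modularLift_mem (A.homogeneousBasis_mem i)).2 γ] at h1
  rw [hs', hfg, Finset.sum_apply, Finset.sum_apply] at hs
  have h2 := congrArg (A.expL1 (c * EisensteinSeries.E2 τ)) hs
  simp only [map_sum, Pi.smul_apply', map_smul, hc, expL1_modularLift] at h2
  rw [← sub_eq_zero, ← Finset.sum_sub_distrib] at h2
  simp only [← sub_smul] at h2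
  exact sub_eq_zero.mp (linearIndependent_iff'.mp A.homogeneousBasis.linearIndependent T _ h2 i hi)

/-! ### Dimensions -/

/-- The indices of the basis vectors of weight between `0` and `k / 2`. -/
noncomputable def indexFinset (k : ℤ) : Finset A.Index :=
  (Finset.Icc 0 (k / 2)).sigma fun _ => Finset.univ

/-- The map sending a family of modular forms `g_i` of weight `k - 2 deg b_i` to
`∑ i, g_i exp(-(2πi / 12) E₂ L(1)) b_i`. -/
noncomputable def ofCoordinates (k : ℤ) :
    ((i : A.indexFinset k) → modularFormSpace (k - 2 * i.1.1)) →ₗ[ℂ] A.modularForms k where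
  toFun g := ∑ i, ⟨(g i : ℍ → ℂ) • A.modularLift (A.homogeneousBasis i.1), by
    have h := A.smul_mem_modularForms (g i).2 (A.modularLift_mem (A.homogeneousBasis_mem i.1))
    rwa [sub_add_cancel] at h⟩
  map_add' g g' := by
    rw [← Finset.sum_add_distrib]
    refine Finset.sum_congr rfl fun i _ => Subtype.ext ?_
    exact add_smul _ _ _
  map_smul' c g := by
    rw [Finset.smul_sum]
    refine Finset.sum_congr rfl fun i _ => Subtype.ext ?_
    exact smul_assoc _ _ _

lemma ofCoordinates_apply (k : ℤ)
    (g : (i : A.indexFinset k) → modularFormSpace (k - 2 * i.1.1)) (τ : ℍ) :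
    (A.ofCoordinates k g : ℍ → V) τ =
      ∑ i, (g i : ℍ → ℂ) τ • A.modularLift (A.homogeneousBasis i.1) τ := by
  simp [ofCoordinates]

lemma ofCoordinates_injective (k : ℤ) : Function.Injective (A.ofCoordinates k) := by
  rw [← LinearMap.ker_eq_bot, LinearMap.ker_eq_bot']
  intro g hg
  ext i τ
  have h := congrFun (congrArg Subtype.val hg) τ
  rw [ofCoordinates_apply] at h
  have h2 := congrArg (A.expL1 (2 * Real.pi * Complex.I / 12 * EisensteinSeries.E2 τ)) h
  simp only [map_sum, map_smul, expL1_modularLift, Submodule.coe_zero, Pi.zero_apply,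
    map_zero] at h2
  exact Fintype.linearIndependent_iff.mp
    (A.homogeneousBasis.linearIndependent.comp _ Subtype.val_injective) _ h2 i

lemma ofCoordinates_surjective (hA : A.IsCFTType) (k : ℤ) :
    Function.Surjective (A.ofCoordinates k) := by
  classical
  rintro ⟨f, hf⟩
  obtain ⟨T, g, hg, hfg⟩ := A.exists_sum_of_mem_modularForms hf
  refine ⟨fun i => if h : i.1 ∈ T then ⟨g i.1, hg i.1 h⟩ else 0, Subtype.ext (funext fun τ => ?_)⟩
  refine (A.ofCoordinates_apply k _ τ).trans (Eq.trans ?_ (hfg τ).symm)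
  have h1 : ∀ i : A.indexFinset k,
      (((if h : i.1 ∈ T then ⟨g i.1, hg i.1 h⟩ else 0 : modularFormSpace (k - 2 * i.1.1)) : ℍ → ℂ)
        τ) • A.modularLift (A.homogeneousBasis i.1) τ =
      if i.1 ∈ T then g i.1 τ • A.modularLift (A.homogeneousBasis i.1) τ else 0 := by
    intro i
    split_ifs <;> simp
  rw [Finset.sum_congr rfl fun i _ => h1 i,
    Finset.sum_coe_sort (A.indexFinset k) fun i =>
      if i ∈ T then g i τ • A.modularLift (A.homogeneousBasis i) τ else 0,
    Finset.sum_ite_mem]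
  refine Finset.sum_subset Finset.inter_subset_right fun i hi hn => ?_
  have h2 : i ∉ A.indexFinset k := fun h => hn (Finset.mem_inter.mpr ⟨h, hi⟩)
  have h3 : 0 ≤ i.1 := by
    by_contra! h
    have h4 := i.2.2
    have h5 : Module.finrank ℂ (A.gr i.1) = 0 := by rw [A.gr_eq_bot_of_neg hA h, finrank_bot]
    omega
  have h4 : k - 2 * i.1 < 0 := by
    simp only [indexFinset, Finset.mem_sigma, Finset.mem_Icc, Finset.mem_univ, and_true] at h2
    omega
  have h5 := hg i hi
  rw [modularFormSpace_eq_bot (Or.inr h4), Submodule.mem_bot] at h5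
  rw [h5, Pi.zero_apply, zero_smul]

/-- The coordinates of `V`-valued modular forms of weight `k`. -/
noncomputable def coordinatesEquiv (hA : A.IsCFTType) (k : ℤ) :
    ((i : A.indexFinset k) → modularFormSpace (k - 2 * i.1.1)) ≃ₗ[ℂ] A.modularForms k :=
  LinearEquiv.ofBijective (A.ofCoordinates k)
    ⟨A.ofCoordinates_injective k, A.ofCoordinates_surjective hA k⟩

lemma finiteDimensional_modularForms (hA : A.IsCFTType) (k : ℤ) :
    FiniteDimensional ℂ (A.modularForms k) :=
  (A.coordinatesEquiv hA k).finiteDimensional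

lemma finrank_modularForms (hA : A.IsCFTType) (n : ℕ) :
    Module.finrank ℂ (A.modularForms (2 * n)) = ∑ i ∈ Finset.range (n + 1),
      Module.finrank ℂ (modularFormSpace (2 * i)) * Module.finrank ℂ (A.gr (n - i)) := by
  rw [← (A.coordinatesEquiv hA (2 * n)).finrank_eq, Module.finrank_pi_fintype,
    Finset.sum_coe_sort (A.indexFinset (2 * n)) fun i =>
      Module.finrank ℂ (modularFormSpace (2 * n - 2 * i.1)), indexFinset, Finset.sum_sigma]
  refine Finset.sum_nbij' (fun d => (n - d).toNat) (fun i => n - i) ?_ ?_ ?_ ?_ ?_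
  · intro d hd
    simp only [Finset.mem_Icc, Finset.mem_range] at hd ⊢
    omega
  · intro i hi
    simp only [Finset.mem_Icc, Finset.mem_range] at hi ⊢
    omega
  · intro d hd
    simp only [Finset.mem_Icc] at hd
    omega
  · intro i hi
    simp
  · intro d hd
    simp only [Finset.mem_Icc] at hd
    have h : ((n - d).toNat : ℤ) = n - d := by omega
    rw [h, sub_sub_cancel, mul_sub]
    refine (Finset.sum_const (Module.finrank ℂ (modularFormSpace (2 * n - 2 * d)))).trans ?_
    rw [Finset.card_univ, Fintype.card_fin, smul_eq_mul]
    exact Nat.mul_comm _ _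

lemma modularForms_eq_bot (hA : A.IsCFTType) {k : ℤ} (hk : Odd k ∨ k < 0) :
    A.modularForms k = ⊥ := by
  rw [Submodule.eq_bot_iff]
  intro f hf
  obtain ⟨g, hg⟩ := A.ofCoordinates_surjective hA k ⟨f, hf⟩
  have hg0 : g = 0 := by
    funext i
    have h0 : modularFormSpace (k - 2 * i.1.1) = ⊥ := by
      refine modularFormSpace_eq_bot (hk.imp (fun h => h.sub_even (even_two_mul _)) fun h => ?_)
      have h1 := i.2
      simp only [indexFinset, Finset.mem_sigma, Finset.mem_Icc] at h1
      omega
    exact Subtype.ext ((Submodule.mem_bot ℂ).mp (h0 ▸ (g i).2))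
  rw [hg0, map_zero] at hg
  exact (congrArg Subtype.val hg).symm

/-! ### The tensor product gradings -/

section Grading

variable {X : Type*} [AddCommGroup X] [Module ℂ X] {𝒜 : ℤ → Submodule ℂ X}

lemma tmul_mem_tensorGrading {k n : ℤ} {f : X} (hf : f ∈ 𝒜 (k - 2 * n)) {v : V}
    (hv : v ∈ A.gr n) : f ⊗ₜ[ℂ] v ∈ tensorGrading 𝒜 A.doubledGrading k := by
  refine Submodule.mem_iSup_of_mem (k - 2 * n, 2 * n)
    (Submodule.mem_iSup_of_mem (sub_add_cancel k (2 * n)) ?_)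
  refine Submodule.apply_mem_map₂ (TensorProduct.mk ℂ X V) hf ?_
  rw [doubledGrading, if_pos (even_two_mul n), Int.mul_ediv_cancel_left n two_ne_zero]
  exact hv

lemma tensorGrading_le {k : ℤ} {S : Submodule ℂ (X ⊗[ℂ] V)}
    (h : ∀ (n : ℤ), ∀ f ∈ 𝒜 (k - 2 * n), ∀ v ∈ A.gr n, f ⊗ₜ[ℂ] v ∈ S) :
    tensorGrading 𝒜 A.doubledGrading k ≤ S := by
  refine iSup₂_le fun p hp => Submodule.map₂_le.mpr fun f hf v hv => ?_
  rw [doubledGrading] at hv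
  split_ifs at hv with he
  · obtain ⟨m, hm⟩ := he
    rw [Set.mem_ofPred_eq] at hp
    refine h (p.2 / 2) f ?_ v hv
    convert! hf using 2
    omega
  · rw [(Submodule.mem_bot ℂ).mp hv, map_zero]
    exact S.zero_mem

end Grading

/-! ### The evaluation map -/

/-- The map `Q ⊗ V → (ℍ → V)` with `f ⊗ v ↦ f v`. -/
noncomputable def evalTensor :
    (quasiModularAlgebra ⊗[ℂ] V) →ₗ[quasiModularAlgebra] (ℍ → V) :=
  TensorProduct.AlgebraTensorModule.lift
    { toFun := fun f =>
        { toFun := fun v τ => (f : ℍ → ℂ) τ • v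
          map_add' := fun v w => by ext τ; exact smul_add _ _ _
          map_smul' := fun c v => by ext τ; exact smul_comm _ _ _ }
      map_add' := fun f g => by ext v τ; exact add_smul _ _ _
      map_smul' := fun f g => by ext v τ; exact mul_smul _ _ _ }

lemma evalTensor_tmul (f : quasiModularAlgebra) (v : V) (τ : ℍ) :
    evalTensor (f ⊗ₜ[ℂ] v) τ = (f : ℍ → ℂ) τ • v := rfl

lemma repr_evalTensor {κ : Type*} (b : Module.Basis κ ℂ V) (x : quasiModularAlgebra ⊗[ℂ] V)
    (i : κ) (τ : ℍ) : b.repr (evalTensor x τ) i =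
      ((Algebra.TensorProduct.basis quasiModularAlgebra b).repr x i : ℍ → ℂ) τ := by
  induction x using TensorProduct.induction_on with
  | zero =>
    rw [LinearMap.map_zero, LinearEquiv.map_zero, Pi.zero_apply, LinearEquiv.map_zero]
    rfl
  | tmul f v =>
    rw [evalTensor_tmul, map_smul, Algebra.TensorProduct.basis_repr_tmul]
    simp only [Finsupp.smul_apply, Finsupp.mapRange_apply, smul_eq_mul]
    rfl
  | add x y hx hy =>
    rw [map_add, Pi.add_apply, map_add, map_add, Finsupp.add_apply, Finsupp.add_apply, hx, hy]
    rfl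

lemma evalTensor_injective :
    Function.Injective (evalTensor : quasiModularAlgebra ⊗[ℂ] V → ℍ → V) := by
  intro x y h
  let b := Module.Basis.ofVectorSpace ℂ V
  refine (Algebra.TensorProduct.basis quasiModularAlgebra b).ext_elem fun i => ?_
  refine Subtype.ext (funext fun τ => ?_)
  rw [← repr_evalTensor, ← repr_evalTensor, h]

lemma evalTensor_mem {k : ℤ} {x : quasiModularAlgebra ⊗[ℂ] V}
    (hx : x ∈ tensorGrading quasiModularGrading A.doubledGrading k) :
    evalTensor x ∈ A.quasiModularForms k := by
  have h := A.tensorGrading_le (k := k) (𝒜 := quasiModularGrading)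
    (S := (A.quasiModularForms k).comap (evalTensor.restrictScalars ℂ)) fun n f hf v hv => by
      have h1 := A.smul_mem_quasiModularForms (Submodule.mem_comap.mp hf)
        (A.const_mem_quasiModularForms hv)
      rw [sub_add_cancel] at h1
      exact h1
  exact h hx

lemma exists_evalTensor_eq {k : ℤ} {f : ℍ → V} (hf : f ∈ A.quasiModularForms k) :
    ∃ x ∈ tensorGrading quasiModularGrading A.doubledGrading k, evalTensor x = f := by
  obtain ⟨T, g, hg, hgf⟩ := A.exists_sum_of_mem_quasiModularForms hf
  refine ⟨∑ i ∈ T, (⟨g i, mem_quasiModularAlgebra.mpr (Submodule.mem_iSup_of_mem _ (hg i))⟩ :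
    quasiModularAlgebra) ⊗ₜ[ℂ] A.homogeneousBasis i, Submodule.sum_mem _ fun i _ =>
      A.tmul_mem_tensorGrading (𝒜 := quasiModularGrading) (Submodule.mem_comap.mpr (hg i))
        (A.homogeneousBasis_mem i), ?_⟩
  ext τ
  rw [map_sum, Finset.sum_apply, hgf]
  rfl

/-- Every element of `Q ⊗ V` is a sum of homogeneous ones. -/
lemma iSup_tensorGrading_eq_top {X : Type*} [AddCommGroup X] [Module ℂ X] {𝒜 : ℤ → Submodule ℂ X}
    (h𝒜 : ⨆ k, 𝒜 k = ⊤) : ⨆ k, tensorGrading 𝒜 A.doubledGrading k = ⊤ := by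
  rw [eq_top_iff]
  intro x _
  induction x using TensorProduct.induction_on with
  | zero => exact Submodule.zero_mem _
  | add x y hx hy => exact Submodule.add_mem _ (hx trivial) (hy trivial)
  | tmul f v =>
    have hf : f ∈ ⨆ k, 𝒜 k := by rw [h𝒜]; trivial
    have hv : v ∈ ⨆ n, A.gr n := by rw [A.isInternal.submodule_iSup_eq_top]; trivial
    induction hf using Submodule.iSup_induction' with
    | zero => rw [zero_tmul]; exact Submodule.zero_mem _
    | add f g _ _ hf hg => rw [add_tmul]; exact Submodule.add_mem _ (hf trivial) (hg trivial)
    | mem k f hf =>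
      induction hv using Submodule.iSup_induction' with
      | zero => rw [tmul_zero]; exact Submodule.zero_mem _
      | add v w _ _ hv hw => rw [tmul_add]; exact Submodule.add_mem _ (hv trivial) (hw trivial)
      | mem n v hv =>
        exact Submodule.mem_iSup_of_mem (k + 2 * n)
          (A.tmul_mem_tensorGrading (by rwa [add_sub_cancel_right]) hv)

end QVOA

lemma iSup_comap_val_eq_top {S : Subalgebra ℂ (ℍ → ℂ)} {p : ℤ → Submodule ℂ (ℍ → ℂ)}
    (hS : ∀ f, f ∈ S ↔ f ∈ ⨆ k, p k) : ⨆ k, (p k).comap S.val.toLinearMap = ⊤ := by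
  rw [eq_top_iff]
  rintro ⟨f, hf⟩ -
  suffices h : ∀ g ∈ ⨆ k, p k, ∀ hg : g ∈ S,
      (⟨g, hg⟩ : S) ∈ ⨆ k, (p k).comap S.val.toLinearMap from h f ((hS f).mp hf) hf
  intro g hg
  induction hg using Submodule.iSup_induction' with
  | zero => exact fun _ => Submodule.zero_mem _
  | add a b ha hb iha ihb =>
    exact fun h => Submodule.add_mem _ (iha ((hS a).mpr ha)) (ihb ((hS b).mpr hb))
  | mem k a ha => exact fun h => Submodule.mem_iSup_of_mem k ha

lemma iSup_quasiModularGrading : ⨆ k, quasiModularGrading k = ⊤ :=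
  iSup_comap_val_eq_top fun _ => mem_quasiModularAlgebra

lemma iSup_modularGrading : ⨆ k, modularGrading k = ⊤ :=
  iSup_comap_val_eq_top fun _ => mem_modularAlgebra

namespace QVOA

variable {V : Type*} [AddCommGroup V] [Module ℂ V] (A : QVOA V)

lemma evalTensor_mem_quasiModularModule (x : quasiModularAlgebra ⊗[ℂ] V) :
    evalTensor x ∈ A.quasiModularModule := by
  have h : (⊤ : Submodule ℂ (quasiModularAlgebra ⊗[ℂ] V)) ≤
      (⨆ k, A.quasiModularForms k).comap (evalTensor.restrictScalars ℂ) := by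
    rw [← A.iSup_tensorGrading_eq_top iSup_quasiModularGrading]
    exact iSup_le fun k x hx => Submodule.mem_iSup_of_mem k (A.evalTensor_mem hx)
  exact h trivial

lemma exists_evalTensor_eq_of_mem {f : ℍ → V} (hf : f ∈ A.quasiModularModule) :
    ∃ x, evalTensor x = f := by
  have h : (⨆ k, A.quasiModularForms k) ≤ LinearMap.range (evalTensor.restrictScalars ℂ) :=
    iSup_le fun k f hf => by
      obtain ⟨x, -, hx⟩ := A.exists_evalTensor_eq hf
      exact ⟨x, hx⟩
  exact h hf

/-- The isomorphism `ι : Q ⊗ V ≃ Q(V)` with `ι(f ⊗ v)(τ) = f(τ) v`. -/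
noncomputable def evalEquiv :
    (quasiModularAlgebra ⊗[ℂ] V) ≃ₗ[quasiModularAlgebra] A.quasiModularModule :=
  LinearEquiv.ofBijective (evalTensor.codRestrict A.quasiModularModule
      A.evalTensor_mem_quasiModularModule)
    ⟨fun _ _ h => evalTensor_injective (congrArg Subtype.val h), fun f => by
      obtain ⟨x, hx⟩ := A.exists_evalTensor_eq_of_mem f.2
      exact ⟨x, Subtype.ext hx⟩⟩

/-! ### The operator `P` -/

lemma locExp_mulL1_tmul (f g : quasiModularAlgebra) (v : V) {n : ℕ} (hn : (A.L1 ^ n) v = 0)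
    (h : IsLocNilpotent (A.mulL1 f)) :
    locExp (A.mulL1 f) h (g ⊗ₜ[ℂ] v) = ∑ i ∈ Finset.range n,
      ((i.factorial : ℂ)⁻¹ • (f ^ i * g)) ⊗ₜ[ℂ] (A.L1 ^ i) v := by
  rw [locExp_apply_of_pow_eq_zero (n := n) h (by rw [mulL1_pow_tmul, hn, tmul_zero])]
  refine Finset.sum_congr rfl fun i _ => ?_
  rw [mulL1_pow_tmul, smul_tmul', smul_eq_mul, IsScalarTower.algebraMap_apply ℚ ℂ,
    ← Algebra.smul_def]
  simp

/-- Under evaluation `exp(f ⊗ L(1))` becomes the pointwise application of `exp(f(τ) L(1))`. -/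
lemma evalTensor_locExp_mulL1 (f : quasiModularAlgebra) (h : IsLocNilpotent (A.mulL1 f))
    (x : quasiModularAlgebra ⊗[ℂ] V) (τ : ℍ) :
    evalTensor (locExp (A.mulL1 f) h x) τ = A.expL1 ((f : ℍ → ℂ) τ) (evalTensor x τ) := by
  induction x using TensorProduct.induction_on with
  | zero => simp only [map_zero, Pi.zero_apply]
  | add x y hx hy => simp only [map_add, Pi.add_apply, hx, hy]
  | tmul g v =>
    obtain ⟨n, hn⟩ := A.L1_locNilpotent v
    rw [A.locExp_mulL1_tmul f g v hn, map_sum, Finset.sum_apply, evalTensor_tmul, map_smul,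
      A.expL1_apply hn, Finset.smul_sum]
    refine Finset.sum_congr rfl fun i _ => ?_
    rw [evalTensor_tmul, smul_smul]
    congr 1
    change (i.factorial : ℂ)⁻¹ * ((f : ℍ → ℂ) τ ^ i * (g : ℍ → ℂ) τ) = _
    ring

lemma neg_mulL1 (f : quasiModularAlgebra) : -A.mulL1 f = A.mulL1 (-f) := by
  refine LinearMap.ext fun x => ?_
  induction x using TensorProduct.induction_on with
  | zero => simp only [map_zero]
  | add x y hx hy => simp only [map_add, hx, hy]
  | tmul g v =>
    change -((f * g) ⊗ₜ[ℂ] A.L1 v) = (-f * g) ⊗ₜ[ℂ] A.L1 v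
    rw [← neg_tmul]
    exact congrArg (· ⊗ₜ[ℂ] A.L1 v) (neg_mul f g).symm

lemma locExp_mulL1_mem_tensorGrading
    {T : Module.End quasiModularAlgebra (quasiModularAlgebra ⊗[ℂ] V)}
    (h : IsLocNilpotent T) {c : ℂ} (hT : T = A.mulL1 (c • E2)) {k : ℤ}
    {x : quasiModularAlgebra ⊗[ℂ] V}
    (hx : x ∈ tensorGrading quasiModularGrading A.doubledGrading k) :
    locExp T h x ∈ tensorGrading quasiModularGrading A.doubledGrading k := by
  subst hT
  refine A.tensorGrading_le (k := k) (𝒜 := quasiModularGrading)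
    (S := (tensorGrading quasiModularGrading A.doubledGrading k).comap
      ((locExp (A.mulL1 (c • E2)) h).restrictScalars ℂ)) (fun n f hf v hv => ?_) hx
  obtain ⟨m, hm⟩ := A.L1_locNilpotent v
  rw [Submodule.mem_comap, LinearMap.restrictScalars_apply, A.locExp_mulL1_tmul _ f v hm]
  refine Submodule.sum_mem _ fun i _ =>
    A.tmul_mem_tensorGrading (𝒜 := quasiModularGrading) (Submodule.smul_mem _ _ ?_)
      (A.L1_pow_mem hv i)
  have h1 : ((c • E2) ^ i * f : quasiModularAlgebra) = c ^ i • (E2 ^ i * f) := by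
    rw [smul_pow, smul_mul_assoc]
  rw [h1]
  refine Submodule.smul_mem _ _ ?_
  have h2 := SetLike.mul_mem_graded (E2_pow_mem i) (Submodule.mem_comap.mp hf)
  rw [show (2 * i : ℤ) + (k - 2 * n) = k - 2 * (n - i) by ring] at h2
  exact h2

lemma mem_tensorGrading_iff_P_mem (k : ℤ) (x : quasiModularAlgebra ⊗[ℂ] V) :
    x ∈ tensorGrading quasiModularGrading A.doubledGrading k ↔
      A.P x ∈ tensorGrading quasiModularGrading A.doubledGrading k := by
  refine ⟨fun hx => A.locExp_mulL1_mem_tensorGrading (A.mulL1_locNilpotent _) rfl hx,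
    fun hx => ?_⟩
  have h1 : A.P.symm (A.P x) ∈ tensorGrading quasiModularGrading A.doubledGrading k :=
    A.locExp_mulL1_mem_tensorGrading (A.mulL1_locNilpotent _).neg
      ((A.neg_mulL1 _).trans (congrArg A.mulL1 (neg_smul _ E2).symm)) hx
  rwa [LinearEquiv.symm_apply_apply] at h1

/-! ### The isomorphism onto modular forms -/

lemma tensorInclusion_smul (f : modularAlgebra) (x : modularAlgebra ⊗[ℂ] V) :
    tensorInclusion V (f • x) =
      Subalgebra.inclusion modularAlgebra_le f • tensorInclusion V x := by
  induction x using TensorProduct.induction_on with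
  | zero => simp only [smul_zero, map_zero]
  | add x y hx hy => simp only [smul_add, map_add, hx, hy]
  | tmul g v => rfl

lemma tensorInclusion_injective : Function.Injective (tensorInclusion V) :=
  Module.Flat.rTensor_preserves_injective_linearMap
    (Subalgebra.inclusion modularAlgebra_le).toLinearMap
    (Subalgebra.inclusion_injective modularAlgebra_le)

/-- The map `ι ∘ P` on `M ⊗ V`. -/
noncomputable def modularEval : (modularAlgebra ⊗[ℂ] V) →ₗ[modularAlgebra] (ℍ → V) where
  toFun x := evalTensor (A.P (tensorInclusion V x))
  map_add' x y := by rw [map_add, map_add, map_add]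
  map_smul' f x := by
    rw [tensorInclusion_smul, map_smul, map_smul]
    rfl

lemma modularEval_tmul (f : modularAlgebra) (v : V) :
    A.modularEval (f ⊗ₜ[ℂ] v) = (f : ℍ → ℂ) • A.modularLift v := by
  ext τ
  refine (A.evalTensor_locExp_mulL1 _ (A.mulL1_locNilpotent _) _ τ).trans ?_
  exact map_smul (A.expL1 _) ((f : ℍ → ℂ) τ) v

lemma modularEval_injective : Function.Injective A.modularEval := fun _ _ h =>
  tensorInclusion_injective (A.P.injective (evalTensor_injective h))

lemma modularEval_mem {k : ℤ} {x : modularAlgebra ⊗[ℂ] V}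
    (hx : x ∈ tensorGrading modularGrading A.doubledGrading k) :
    A.modularEval x ∈ A.modularForms k := by
  have h := A.tensorGrading_le (k := k) (𝒜 := modularGrading)
    (S := (A.modularForms k).comap (A.modularEval.restrictScalars ℂ)) fun n f hf v hv => by
      have h1 := A.smul_mem_modularForms (Submodule.mem_comap.mp hf) (A.modularLift_mem hv)
      rw [sub_add_cancel] at h1
      rw [Submodule.mem_comap, LinearMap.restrictScalars_apply, modularEval_tmul]
      exact h1
  exact h hx

lemma exists_modularEval_eq {k : ℤ} {f : ℍ → V} (hf : f ∈ A.modularForms k) :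
    ∃ x ∈ tensorGrading modularGrading A.doubledGrading k, A.modularEval x = f := by
  obtain ⟨T, g, hg, hgf⟩ := A.exists_sum_of_mem_modularForms hf
  refine ⟨∑ i : T, (⟨g i, mem_modularAlgebra.mpr (Submodule.mem_iSup_of_mem _ (hg i i.2))⟩ :
    modularAlgebra) ⊗ₜ[ℂ] A.homogeneousBasis i, Submodule.sum_mem _ fun i _ =>
      A.tmul_mem_tensorGrading (𝒜 := modularGrading) (Submodule.mem_comap.mpr (hg i i.2))
        (A.homogeneousBasis_mem i), ?_⟩
  ext τ
  rw [map_sum, Finset.sum_apply, hgf,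
    ← Finset.sum_coe_sort T fun i => g i τ • A.modularLift (A.homogeneousBasis i) τ]
  refine Finset.sum_congr rfl fun i _ => ?_
  rw [modularEval_tmul]
  rfl

lemma modularEval_mem_modularModule (x : modularAlgebra ⊗[ℂ] V) :
    A.modularEval x ∈ A.modularModule := by
  have h : (⊤ : Submodule ℂ (modularAlgebra ⊗[ℂ] V)) ≤
      (⨆ k, A.modularForms k).comap (A.modularEval.restrictScalars ℂ) := by
    rw [← A.iSup_tensorGrading_eq_top iSup_modularGrading]
    exact iSup_le fun k x hx => Submodule.mem_iSup_of_mem k (A.modularEval_mem hx)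
  exact h trivial

lemma exists_modularEval_eq_of_mem {f : ℍ → V} (hf : f ∈ A.modularModule) :
    ∃ x, A.modularEval x = f := by
  have h : (⨆ k, A.modularForms k) ≤ LinearMap.range (A.modularEval.restrictScalars ℂ) :=
    iSup_le fun k f hf => by
      obtain ⟨x, -, hx⟩ := A.exists_modularEval_eq hf
      exact ⟨x, hx⟩
  exact h hf

/-- The isomorphism `ι ∘ P : M ⊗ V ≃ M(V)`. -/
noncomputable def modularEquiv :
    (modularAlgebra ⊗[ℂ] V) ≃ₗ[modularAlgebra] A.modularModule :=
  LinearEquiv.ofBijective (A.modularEval.codRestrict A.modularModule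
      A.modularEval_mem_modularModule)
    ⟨fun _ _ h => A.modularEval_injective (congrArg Subtype.val h), fun f => by
      obtain ⟨x, hx⟩ := A.exists_modularEval_eq_of_mem f.2
      exact ⟨x, Subtype.ext hx⟩⟩

end QVOA

theorem theorem1p2 {V : Type*} [AddCommGroup V] [Module ℂ V] (A : QVOA V) (hA : A.IsCFTType) :
    iSupIndep A.modularForms ∧ iSupIndep A.quasiModularForms ∧
    (∃ (ι : (quasiModularAlgebra ⊗[ℂ] V) ≃ₗ[quasiModularAlgebra] A.quasiModularModule)
        (PM : (modularAlgebra ⊗[ℂ] V) ≃ₗ[modularAlgebra] A.modularModule),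
      (∀ f v, (ι (f ⊗ₜ[ℂ] v) : ℍ → V) = fun τ => (f : ℍ → ℂ) τ • v) ∧
      (∀ k x, x ∈ tensorGrading quasiModularGrading A.doubledGrading k ↔
        (ι x : ℍ → V) ∈ A.quasiModularForms k) ∧
      (∀ k x, x ∈ tensorGrading quasiModularGrading A.doubledGrading k ↔
        A.P x ∈ tensorGrading quasiModularGrading A.doubledGrading k) ∧
      (∀ x, (PM x : ℍ → V) = ι (A.P (tensorInclusion V x))) ∧
      (∀ k x, x ∈ tensorGrading modularGrading A.doubledGrading k ↔
        (PM x : ℍ → V) ∈ A.modularForms k)) ∧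
    (∀ k, FiniteDimensional ℂ (A.modularForms k)) ∧
    (∀ n : ℕ, Module.finrank ℂ (A.modularForms (2 * n)) =
      ∑ i ∈ Finset.range (n + 1),
        Module.finrank ℂ (modularFormSpace (2 * i)) * Module.finrank ℂ (A.gr (n - i))) ∧
    (∀ k : ℤ, Odd k ∨ k < 0 → A.modularForms k = ⊥) := by
  refine ⟨A.iSupIndep_modularForms, A.iSupIndep_quasiModularForms,
    ⟨A.evalEquiv, A.modularEquiv, fun _ _ => rfl, fun k x => ⟨A.evalTensor_mem, fun hx => ?_⟩,
      A.mem_tensorGrading_iff_P_mem, fun _ => rfl, fun k x => ⟨A.modularEval_mem, fun hx => ?_⟩⟩,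
    A.finiteDimensional_modularForms hA, A.finrank_modularForms hA,
    fun _ => A.modularForms_eq_bot hA⟩
  · obtain ⟨y, hy, hyx⟩ := A.exists_evalTensor_eq hx
    rwa [← QVOA.evalTensor_injective hyx]
  · obtain ⟨y, hy, hyx⟩ := A.exists_modularEval_eq hx
    rwa [← A.modularEval_injective hyx]
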